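/- Let $k$ be a field, let $B$ be the $k$-algebra $k\langle x,y\rangle/(x^2,y^2,xyx,yxy)$, let $0\neq q\in k$, put $w=xy-qyx\in B$ and $A=B/(w)\simeq k\langle x,y\rangle/(x^2,xy-qyx,y^2)$. Let $\nu$ be the algebra automorphism of $B$ with $\nu(x)=-q^{-1}x$ and $\nu(y)=-qy$; it satisfies $\nu(bw)=bw$ for all $b\in B$. Let $\mathscr F(B)$ be the category of finitely generated free left $B$-modules, $S_\nu\colon\mathscr F(B)\to\mathscr F(B)$, $F\mapsto{}_\nu F$, the functor twisting the action of $B$ by $\nu$ (and acting as the identity on maps), and $\eta_w\colon 1_{\mathscr F(B)}\to S_\nu$ the natural transformation with coordinates $\eta_F\colon F\to{}_\nu F$, $\eta_F(m)=wm$. Let $\mathbf{HFact}(\mathscr F(B),S_\nu,\eta_w)$ be the homotopy category of factorizations of $\eta_w$. Its objects are the factorizations $(F,G,f,g)$, that is, $F\xrightarrow{f}G\xrightarrow{g}{}_\nu F$ in $\mathscr F(B)$ with $g\circ f=\eta_F$ and $(S_\nu f)\circ g=\eta_G$. Its morphisms $(F_1,G_1,f_1,g_1)\to(F_2,G_2,f_2,g_2)$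 are the pairs $(\psi\colon F_1\to F_2,\ \phi\colon G_1\to G_2)$ with $\phi f_1=f_2\psi$ and $(S_\nu\psi)g_1=g_2\phi$, modulo homotopy: $(\psi,\phi)\sim(\psi',\phi')$ if there are maps $s\colon G_1\to F_2$ and $t\colon S_\nu F_1\to G_2$ with $\psi-\psi'=sf_1+S_\nu^{-1}(g_2t)$ and $\phi-\phi'=tg_1+f_2s$. Its suspension is $\Sigma(F,G,f,g)=(G,S_\nu F,-g,-S_\nu f)$, and its distinguished triangles are those isomorphic to a mapping cone triangle $X\to Y\to C_\theta\to\Sigma X$. Let $\underline{\mathrm{mod}}\,A$ be the stable module category of finitely generated left $A$-modules (maps modulo those that factor through a projective module), with suspension $\Sigma M=I(M)/M$ for the embedding of $M$ into the injective module $I(M)=\mathrm{Hom}_k(A,M)$, and with distinguished triangles those isomorphic to $M\xrightarrow{u}N\to C_u\to\Sigma M$, where $C_u$ is the pushout of $M\hookrightarrow I(M)$ along a map $u\colon M\to N$ of finitely generated modules. Then reduction modulo $w$ induces a triangle functor $$T\colon\mathbf{HFact}(\mathscr F(B),S_\nu,\eta_w)\longrightarrow\underline{\mathrm{mod}}\,A$$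 (an additive functor which, together with a natural isomorphism $T\Sigma\cong\Sigma T$, maps distinguished triangles to distinguished triangles). The image under $T$ of a factorization $(F,G,f,g)$ is the image of the reduced map $\bar f\colon F/wF\to G/wG$, and the image under $T$ of the class of a morphism $(\psi,\phi)$ is the class of the map between these images that is induced by $\phi$. -/

import Mathlib

open CategoryTheory CategoryTheory.Limits

universe v u v' u'

/-! ### Suspended categories, triangles and triangle functors -/

/-- A triangle `X ⟶ Y ⟶ Z ⟶ Sus X` in a category with a suspension functor `Sus`. -/
structure SuspTriangle {C : Type u} [Category.{v} C] (Sus : C ⥤ C) where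
  X : C
  Y : C
  Z : C
  f : X ⟶ Y
  g : Y ⟶ Z
  h : Z ⟶ Sus.obj X

namespace SuspTriangle

/-- Two triangles are isomorphic if there are three isomorphisms between their objects that commute
with all the maps, the third square involving the suspension of the first isomorphism. -/
def Isomorphic {C : Type u} [Category.{v} C] {Sus : C ⥤ C} (t t' : SuspTriangle Sus) : Prop :=
  ∃ (a : t.X ≅ t'.X) (b : t.Y ≅ t'.Y) (c : t.Z ≅ t'.Z),
    t.f ≫ b.hom = a.hom ≫ t'.f ∧ t.g ≫ c.hom = b.hom ≫ t'.g ∧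
      t.h ≫ Sus.map a.hom = c.hom ≫ t'.h

/-- The image of a triangle under a functor `T` that commutes with the suspensions up to the
natural transformation `ξ`. -/
def map {C : Type u} [Category.{v} C] {D : Type u'} [Category.{v'} D] {SusC : C ⥤ C} {SusD : D ⥤ D}
    (T : C ⥤ D) (ξ : SusC ⋙ T ⟶ T ⋙ SusD) (t : SuspTriangle SusC) : SuspTriangle SusD where
  X := T.obj t.X
  Y := T.obj t.Y
  Z := T.obj t.Z
  f := T.map t.f
  g := T.map t.g
  h := T.map t.h ≫ ξ.app t.X

end SuspTriangle

/-- `T` is a triangle functor with respect to the classes `DistC` and `DistD` of distinguished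
triangles: it is additive, and there is a natural isomorphism `T ∘ SusC ≅ SusD ∘ T` with respect to
which it maps distinguished triangles to distinguished triangles. -/
def IsTriangleFunctor {C : Type u} [Category.{v} C] [Preadditive C]
    {D : Type u'} [Category.{v'} D] [Preadditive D] {SusC : C ⥤ C} {SusD : D ⥤ D}
    (DistC : SuspTriangle SusC → Prop) (DistD : SuspTriangle SusD → Prop) (T : C ⥤ D) : Prop :=
  T.Additive ∧ ∃ ξ : SusC ⋙ T ≅ T ⋙ SusD, ∀ t, DistC t → DistD (t.map T ξ.hom)

/-! ### Factorizations of a central element -/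

/-- A central element of the suspended category `(C, S)`: a natural transformation `η : 1 ⟶ S` with
`η_{S M} = S η_M` for all `M`. -/
structure CentralElement {C : Type u} [Category.{v} C] (S : C ⥤ C) where
  η : 𝟭 C ⟶ S
  comm : ∀ M : C, η.app (S.obj M) = S.map (η.app M)

/-- A `(C, S)`-factorization `M ⟶ N ⟶ S M` of the central element `η`. -/
structure Factorization {C : Type u} [Category.{v} C] {S : C ⥤ C} (η : CentralElement S) where
  M : C
  N : C
  f : M ⟶ N
  g : N ⟶ S.obj M
  fg : f ≫ g = η.η.app M
  gf : g ≫ S.map f = η.η.app N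

namespace Factorization

/-- A morphism `(ψ, φ)` of factorizations. -/
@[ext]
structure Hom {C : Type u} [Category.{v} C] {S : C ⥤ C} {η : CentralElement S}
    (X Y : Factorization η) where
  ψ : X.M ⟶ Y.M
  φ : X.N ⟶ Y.N
  comm_f : X.f ≫ φ = ψ ≫ Y.f
  comm_g : X.g ≫ S.map ψ = φ ≫ Y.g

instance {C : Type u} [Category.{v} C] {S : C ⥤ C} {η : CentralElement S} :
    Category.{v} (Factorization η) where
  Hom X Y := Hom X Y
  id X := ⟨𝟙 _, 𝟙 _, by simp, by simp⟩
  comp a b := ⟨a.ψ ≫ b.ψ, a.φ ≫ b.φ,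
    by rw [← Category.assoc, a.comm_f, Category.assoc, b.comm_f, Category.assoc],
    by rw [S.map_comp, ← Category.assoc, a.comm_g, Category.assoc, b.comm_g, Category.assoc]⟩
  id_comp a := Hom.ext (Category.id_comp _) (Category.id_comp _)
  comp_id a := Hom.ext (Category.comp_id _) (Category.comp_id _)
  assoc a b c := Hom.ext (Category.assoc _ _ _) (Category.assoc _ _ _)

section

variable {C : Type u} [Category.{v} C] {S : C ⥤ C} {η : CentralElement S}

@[ext]
theorem hom_ext {X Y : Factorization η} {a b : X ⟶ Y} (h₁ : a.ψ = b.ψ) (h₂ : a.φ = b.φ) : a = b :=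
  Hom.ext h₁ h₂

@[simp] theorem id_ψ (X : Factorization η) : Hom.ψ (𝟙 X) = 𝟙 X.M := rfl
@[simp] theorem id_φ (X : Factorization η) : Hom.φ (𝟙 X) = 𝟙 X.N := rfl
@[simp] theorem comp_ψ {X Y Z : Factorization η} (a : X ⟶ Y) (b : Y ⟶ Z) :
    Hom.ψ (a ≫ b) = a.ψ ≫ b.ψ := rfl
@[simp] theorem comp_φ {X Y Z : Factorization η} (a : X ⟶ Y) (b : Y ⟶ Z) :
    Hom.φ (a ≫ b) = a.φ ≫ b.φ := rfl

variable [Preadditive C] [S.Additive]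

/-- Morphisms of factorizations form an additive subgroup of the pairs of morphisms. -/
def homSubgroup (X Y : Factorization η) : AddSubgroup ((X.M ⟶ Y.M) × (X.N ⟶ Y.N)) where
  carrier := {p | X.f ≫ p.2 = p.1 ≫ Y.f ∧ X.g ≫ S.map p.1 = p.2 ≫ Y.g}
  zero_mem' := by simp
  add_mem' := by
    rintro a b ⟨ha, ha'⟩ ⟨hb, hb'⟩
    simp [ha, hb, ha', hb', Functor.map_add]
  neg_mem' := by
    rintro a ⟨ha, ha'⟩
    simp [ha, ha', Functor.map_neg]

/-- Morphisms of factorizations as elements of the subgroup of compatible pairs. -/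
def homEquiv (X Y : Factorization η) : (X ⟶ Y) ≃ homSubgroup X Y where
  toFun a := ⟨(a.ψ, a.φ), a.comm_f, a.comm_g⟩
  invFun p := ⟨p.1.1, p.1.2, p.2.1, p.2.2⟩
  left_inv _ := rfl
  right_inv _ := rfl

instance (X Y : Factorization η) : AddCommGroup (X ⟶ Y) := (homEquiv X Y).addCommGroup

@[simp] theorem add_ψ {X Y : Factorization η} (a b : X ⟶ Y) : Hom.ψ (a + b) = a.ψ + b.ψ := rfl
@[simp] theorem add_φ {X Y : Factorization η} (a b : X ⟶ Y) : Hom.φ (a + b) = a.φ + b.φ := rfl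

instance : Preadditive (Factorization η) where
  add_comp _ _ _ a b c := by ext <;> simp
  comp_add _ _ _ a b c := by ext <;> simp

/-- Homotopy of morphisms of factorizations: there are diagonal morphisms `s : N₁ ⟶ M₂` and
`t : S M₁ ⟶ N₂` with `ψ - ψ' = s ∘ f₁ + S⁻¹ (g₂ ∘ t)` and `φ - φ' = t ∘ g₁ + f₂ ∘ s`.
Here `r` is `S⁻¹ (g₂ ∘ t)`, the morphism with `S r = g₂ ∘ t`. -/
def homotopic (η : CentralElement S) : HomRel (Factorization η) := fun X Y a b =>
  ∃ (s : X.N ⟶ Y.M) (t : S.obj X.M ⟶ Y.N) (r : X.M ⟶ Y.M), S.map r = t ≫ Y.g ∧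
    a.ψ - b.ψ = X.f ≫ s + r ∧ a.φ - b.φ = X.g ≫ t + s ≫ Y.f

instance homotopic_congruence : Congruence (homotopic η) where
  equivalence := by
    intro X Y
    refine ⟨fun a => ⟨0, 0, 0, by simp, by simp, by simp⟩, ?_, ?_⟩
    · rintro a b ⟨s, t, r, h, h₁, h₂⟩
      refine ⟨-s, -t, -r, by simp [h, Functor.map_neg], ?_, ?_⟩
      · rw [← neg_sub, h₁]; simp; abel
      · rw [← neg_sub, h₂]; simp; abel
    · rintro a b c ⟨s, t, r, h, h₁, h₂⟩ ⟨s', t', r', h', h₁', h₂'⟩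
      refine ⟨s + s', t + t', r + r', by simp [h, h', Functor.map_add], ?_, ?_⟩
      · rw [← sub_add_sub_cancel a.ψ b.ψ, h₁, h₁']; simp; abel
      · rw [← sub_add_sub_cancel a.φ b.φ, h₂, h₂']; simp; abel
  comp_left := by
    rintro X Y Z c a b ⟨s, t, r, h, h₁, h₂⟩
    refine ⟨c.φ ≫ s, S.map c.ψ ≫ t, c.ψ ≫ r, by simp [h], ?_, ?_⟩
    · rw [comp_ψ, comp_ψ, ← Preadditive.comp_sub, h₁, Preadditive.comp_add, ← Category.assoc,
        ← c.comm_f, Category.assoc]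
    · rw [comp_φ, comp_φ, ← Preadditive.comp_sub, h₂, Preadditive.comp_add, ← Category.assoc,
        ← c.comm_g, Category.assoc, Category.assoc]
  comp_right := by
    rintro X Y Z a b c ⟨s, t, r, h, h₁, h₂⟩
    refine ⟨s ≫ c.ψ, t ≫ c.φ, r ≫ c.ψ, by simp [h, c.comm_g], ?_, ?_⟩
    · rw [comp_ψ, comp_ψ, ← Preadditive.sub_comp, h₁, Preadditive.add_comp, Category.assoc]
    · rw [comp_φ, comp_φ, ← Preadditive.sub_comp, h₂, Preadditive.add_comp, Category.assoc,
        Category.assoc, Category.assoc, c.comm_f]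

theorem homotopic_add ⦃X Y : Factorization η⦄ (a a' b b' : X ⟶ Y) (h : homotopic η a a')
    (h' : homotopic η b b') : homotopic η (a + b) (a' + b') := by
  obtain ⟨s, t, r, h, h₁, h₂⟩ := h
  obtain ⟨s', t', r', h', h₁', h₂'⟩ := h'
  refine ⟨s + s', t + t', r + r', by simp [h, h', Functor.map_add], ?_, ?_⟩
  · rw [add_ψ, add_ψ, add_sub_add_comm, h₁, h₁']; simp; abel
  · rw [add_φ, add_φ, add_sub_add_comm, h₂, h₂']; simp; abel

/-- The suspension `Σ (M, N, f, g) = (N, S M, -g, -S f)` of factorizations. -/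
def suspension (η : CentralElement S) : Factorization η ⥤ Factorization η where
  obj X :=
    { M := X.N
      N := S.obj X.M
      f := -X.g
      g := -S.map X.f
      fg := by simp [X.gf]
      gf := by
        rw [S.map_neg, Preadditive.neg_comp, Preadditive.comp_neg, neg_neg, ← S.map_comp, X.fg,
          η.comm] }
  map {X Y} a := ⟨a.φ, S.map a.ψ, by simp [a.comm_g], by
    change (-S.map X.f) ≫ S.map a.φ = S.map a.ψ ≫ (-S.map Y.f)
    rw [Preadditive.neg_comp, Preadditive.comp_neg, ← S.map_comp, a.comm_f, S.map_comp]⟩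
  map_id X := by ext <;> simp
  map_comp a b := by ext <;> simp

variable [HasBinaryBiproducts C]

/-- The mapping cone `N₁ ⊕ M₂ ⟶ S M₁ ⊕ N₂ ⟶ S (N₁ ⊕ M₂)` of a morphism of factorizations. Its first
map sends `(n, m)` to `(-g₁ n, φ n + f₂ m)`, its second map sends `(m, n)` to
`(-S f₁ m, S ψ m + g₂ n)`, where `S (N₁ ⊕ M₂)` is `S N₁ ⊕ S M₂` with inclusions `S inl`, `S inr`. -/
noncomputable def cone {X Y : Factorization η} (a : X ⟶ Y) : Factorization η where
  M := X.N ⊞ Y.M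
  N := S.obj X.M ⊞ Y.N
  f := biprod.desc (-X.g ≫ biprod.inl + a.φ ≫ biprod.inr) (Y.f ≫ biprod.inr)
  g := biprod.desc (-S.map X.f ≫ S.map biprod.inl + S.map a.ψ ≫ S.map biprod.inr)
    (Y.g ≫ S.map biprod.inr)
  fg := by
    ext
    · have h₁ : X.g ≫ S.map X.f ≫ S.map (biprod.inl : X.N ⟶ X.N ⊞ Y.M) =
          η.η.app X.N ≫ S.map biprod.inl := by rw [← Category.assoc, X.gf]
      have h₂ : X.g ≫ S.map a.ψ ≫ S.map (biprod.inr : Y.M ⟶ X.N ⊞ Y.M) =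
          a.φ ≫ Y.g ≫ S.map biprod.inr := by
        rw [← Category.assoc, a.comm_g, Category.assoc]
      have h₃ := η.η.naturality (biprod.inl : X.N ⟶ X.N ⊞ Y.M)
      simp only [Functor.id_map] at h₃
      simp [h₁, h₂, h₃]
    · have h₃ := η.η.naturality (biprod.inr : Y.M ⟶ X.N ⊞ Y.M)
      simp only [Functor.id_map] at h₃
      have h₁ : Y.f ≫ Y.g ≫ S.map (biprod.inr : Y.M ⟶ X.N ⊞ Y.M) =
        η.η.app Y.M ≫ S.map biprod.inr := by rw [← Category.assoc, Y.fg]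
      simp [h₁, h₃]
  gf := by
    ext
    · have h₃ := η.η.naturality (biprod.inl : S.obj X.M ⟶ S.obj X.M ⊞ Y.N)
      simp only [Functor.id_map] at h₃
      rw [biprod.inl_desc_assoc, h₃, η.comm, ← X.fg]
      simp only [Preadditive.add_comp, Category.assoc, Preadditive.neg_comp, ← S.map_comp,
        biprod.inl_desc, biprod.inr_desc, Preadditive.comp_add, Preadditive.comp_neg,
        Functor.map_add, Functor.map_neg]
      rw [← Category.assoc X.f a.φ, a.comm_f, Category.assoc]
      abel
    · have h₃ := η.η.naturality (biprod.inr : Y.N ⟶ S.obj X.M ⊞ Y.N)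
      simp only [Functor.id_map] at h₃
      rw [biprod.inr_desc_assoc, h₃, ← Y.gf]
      simp only [Category.assoc, ← S.map_comp, biprod.inr_desc]

/-- The inclusion `i : Y ⟶ C_a` into the mapping cone. -/
noncomputable def coneInr {X Y : Factorization η} (a : X ⟶ Y) : Y ⟶ cone a :=
  ⟨biprod.inr, biprod.inr, by simp [cone], by simp [cone]⟩

/-- The projection `π : C_a ⟶ Σ X` from the mapping cone. -/
noncomputable def coneFst {X Y : Factorization η} (a : X ⟶ Y) : cone a ⟶ (suspension η).obj X :=
  ⟨biprod.fst, biprod.fst, by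
    change biprod.desc _ _ ≫ biprod.fst = biprod.fst ≫ (-X.g)
    apply biprod.hom_ext' <;> simp, by
    change biprod.desc _ _ ≫ S.map biprod.fst = biprod.fst ≫ (-S.map X.f)
    apply biprod.hom_ext'
    · simp only [biprod.inl_desc_assoc, Preadditive.add_comp, Category.assoc,
        Preadditive.neg_comp, ← S.map_comp, biprod.inl_fst, biprod.inr_fst]
      simp
    · simp only [biprod.inr_desc_assoc, Category.assoc, ← S.map_comp, biprod.inr_fst]
      simp⟩

end

end Factorization

/-- The homotopy category of factorizations. -/
abbrev HFactorization {C : Type u} [Category.{v} C] [Preadditive C] {S : C ⥤ C} [S.Additive]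
    (η : CentralElement S) := CategoryTheory.Quotient (Factorization.homotopic η)

namespace HFactorization

section

variable {C : Type u} [Category.{v} C] [Preadditive C] {S : C ⥤ C} [S.Additive]

instance (η : CentralElement S) : Preadditive (HFactorization η) :=
  CategoryTheory.Quotient.preadditive _ Factorization.homotopic_add

/-- The functor from factorizations to their homotopy category. -/
abbrev proj (η : CentralElement S) : Factorization η ⥤ HFactorization η :=
  CategoryTheory.Quotient.functor (Factorization.homotopic η)

/-- The suspension of the homotopy category of factorizations. -/
def suspension (η : CentralElement S) : HFactorization η ⥤ HFactorization η :=
  CategoryTheory.Quotient.lift _ (Factorization.suspension η ⋙ proj η) (by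
    rintro X Y a b ⟨s, t, r, h, h₁, h₂⟩
    refine CategoryTheory.Quotient.sound _ ⟨-t, -S.map s, s ≫ Y.f, ?_, ?_, ?_⟩
    · simp [Factorization.suspension]
    · change a.φ - b.φ = (-X.g) ≫ (-t) + s ≫ Y.f
      simp [h₂]
    · change S.map a.ψ - S.map b.ψ = (-S.map X.f) ≫ (-S.map s) + (-t) ≫ (-Y.g)
      rw [← S.map_sub, h₁]
      simp [h])

/-- The standard triangle `X ⟶ Y ⟶ C_a ⟶ Σ X` of a morphism `a : X ⟶ Y` of factorizations. -/
noncomputable def standardTriangle [HasBinaryBiproducts C] {η : CentralElement S} {X Y : Factorization η}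
    (a : X ⟶ Y) : SuspTriangle (suspension η) where
  X := (proj η).obj X
  Y := (proj η).obj Y
  Z := (proj η).obj (Factorization.cone a)
  f := (proj η).map a
  g := (proj η).map (Factorization.coneInr a)
  h := (proj η).map (Factorization.coneFst a)

/-- The distinguished triangles: those isomorphic to a standard triangle. -/
def Distinguished [HasBinaryBiproducts C] (η : CentralElement S)
    (t : SuspTriangle (suspension η)) : Prop :=
  ∃ (X Y : Factorization η) (a : X ⟶ Y), t.Isomorphic (standardTriangle a)

end

end HFactorization

/-! ### The stable module category -/

/-- Two maps of finitely generated `A`-modules are stably equal if their difference factors through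
a finitely generated projective module. -/
def stablyEqual (A : Type u) [Ring A] : HomRel (FGModuleCat.{u} A) := fun M N f g =>
  ∃ (P : FGModuleCat.{u} A) (_ : Module.Projective A P) (a : M ⟶ P) (b : P ⟶ N), f - g = a ≫ b

namespace stablyEqual

section

variable {A : Type u} [Ring A]

theorem add ⦃M N : FGModuleCat.{u} A⦄ (f f' g g' : M ⟶ N) (h : stablyEqual A f f')
    (h' : stablyEqual A g g') : stablyEqual A (f + g) (f' + g') := by
  obtain ⟨P, hP, a, b, h⟩ := h
  obtain ⟨P', hP', a', b', h'⟩ := h'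
  refine ⟨FGModuleCat.of A (P × P'), inferInstanceAs (Module.Projective A (P × P')),
    FGModuleCat.ofHom (a.hom.hom.prod a'.hom.hom),
    FGModuleCat.ofHom (b.hom.hom.coprod b'.hom.hom), ?_⟩
  rw [add_sub_add_comm, h, h']
  ext x
  rfl

instance : Congruence (stablyEqual A) where
  equivalence := by
    intro M N
    refine ⟨fun f => ⟨FGModuleCat.of A PUnit.{u + 1},
      inferInstanceAs (Module.Projective A PUnit.{u + 1}), 0, 0,
      by simp⟩, ?_, ?_⟩
    · rintro f g ⟨P, hP, a, b, h⟩
      exact ⟨P, hP, a, -b, by rw [← neg_sub, h, Preadditive.comp_neg]⟩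
    · intro f g l h h'
      obtain ⟨P, hP, a, b, h⟩ := add _ _ _ _ h h'
      exact ⟨P, hP, a, b, by rw [← h]; abel⟩
  comp_left := by
    rintro M N L c f g ⟨P, hP, a, b, h⟩
    exact ⟨P, hP, c ≫ a, b, by rw [← Preadditive.comp_sub, h, Category.assoc]⟩
  comp_right := by
    rintro M N L f g c ⟨P, hP, a, b, h⟩
    exact ⟨P, hP, a, b ≫ c, by rw [← Preadditive.sub_comp, h, Category.assoc]⟩

end

end stablyEqual

/-- The stable module category of finitely generated left `A`-modules. -/
abbrev StableModCat (A : Type u) [Ring A] := CategoryTheory.Quotient (stablyEqual A)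

/-- A Frobenius form on a finite-dimensional algebra: a linear functional whose kernel contains no
nonzero left ideal. Its existence says that the algebra is Frobenius, in particular selfinjective. -/
class HasFrobeniusForm (k : Type u) [Field k] (A : Type u) [Ring A] [Algebra k A] : Prop where
  exists_form : ∃ l : A →ₗ[k] k, ∀ c : A, (∀ b : A, l (b * c) = 0) → c = 0

namespace StableModCat

section

variable (k : Type u) [Field k] (A : Type u) [Ring A] [Algebra k A]

instance : Preadditive (StableModCat A) :=
  CategoryTheory.Quotient.preadditive _ stablyEqual.add

/-- The functor from finitely generated modules to the stable category. -/
abbrev proj : FGModuleCat.{u} A ⥤ StableModCat A :=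
  CategoryTheory.Quotient.functor (stablyEqual A)

/-- The functor `I = Hom_k(A, -)` on left `A`-modules, where `A` acts on `Hom_k(A, M)` by
`(a φ)(b) = φ (b a)`. Since `k` is a field, `I M` is an injective `A`-module. -/
noncomputable def inj : ModuleCat.{u} A ⥤ ModuleCat.{u} A :=
  ModuleCat.restrictScalars (algebraMap k A) ⋙ ModuleCat.coextendScalars (algebraMap k A)

/-- The natural embedding `M ⟶ I M = Hom_k(A, M)`, `m ↦ (b ↦ b m)`, of a module into an injective
module. -/
noncomputable def toInj : 𝟭 (ModuleCat.{u} A) ⟶ inj k A :=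
  (ModuleCat.restrictCoextendScalarsAdj.{u, u, u} (algebraMap k A)).unit

variable {A}

/-- Elements of `I M` are determined by their values. -/
noncomputable def injEval (M : ModuleCat.{u} A) (φ : (inj k A).obj M) (b : A) : M :=
  ModuleCat.CoextendScalars.equiv (algebraMap k A) _ φ b

theorem injEval_ext {M : ModuleCat.{u} A} {φ φ' : (inj k A).obj M}
    (h : ∀ b, injEval k M φ b = injEval k M φ' b) : φ = φ' :=
  ModuleCat.CoextendScalars.ext (LinearMap.ext h)

theorem injEval_toInj (M : ModuleCat.{u} A) (m : M) (b : A) :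
    injEval k M ((toInj k A).app M m) b = b • m := rfl

theorem injEval_smul (M : ModuleCat.{u} A) (a : A) (φ : (inj k A).obj M) (b : A) :
    injEval k M (a • φ) b = injEval k M φ (b * a) := rfl

theorem injEval_map {M N : ModuleCat.{u} A} (f : M ⟶ N) (φ : (inj k A).obj M) (b : A) :
    injEval k N ((inj k A).map f φ) b = f (injEval k M φ b) := rfl

theorem toInj_injective (M : ModuleCat.{u} A) : Function.Injective ((toInj k A).app M) := by
  intro m m' h
  have := congrArg (fun φ => injEval k M φ 1) h
  simpa only [injEval_toInj, one_smul] using this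

theorem injEval_add_right (M : ModuleCat.{u} A) (φ : (inj k A).obj M) (b b' : A) :
    injEval k M φ (b + b') = injEval k M φ b + injEval k M φ b' :=
  map_add (ModuleCat.CoextendScalars.equiv (algebraMap k A) _ φ) b b'

theorem injEval_smul_right (M : ModuleCat.{u} A) (φ : (inj k A).obj M) (c : k) (b : A) :
    injEval k M φ (c • b) = algebraMap k A c • injEval k M φ b := by
  rw [Algebra.smul_def]
  exact LinearMap.map_smul (ModuleCat.CoextendScalars.equiv (algebraMap k A) _ φ) c b

variable [Module.Finite k A]

theorem form_surjective {l : A →ₗ[k] k} (hl : ∀ c : A, (∀ b : A, l (b * c) = 0) → c = 0)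
    (μ : A →ₗ[k] k) : ∃ c : A, ∀ b, l (b * c) = μ b := by
  let L : A →ₗ[k] (A →ₗ[k] k) := (LinearMap.mul k A).flip.compr₂ l
  have hL : ∀ c b, L c b = l (b * c) := fun c b => rfl
  have hinj : Function.Injective L := by
    rw [← LinearMap.ker_eq_bot, LinearMap.ker_eq_bot']
    intro c hc
    exact hl c fun b => by rw [← hL, hc, LinearMap.zero_apply]
  have hsurj : Function.Surjective L :=
    (LinearMap.injective_iff_surjective_of_finrank_eq_finrank
      (Subspace.dual_finrank_eq (K := k) (V := A)).symm).1 hinj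
  obtain ⟨c, hc⟩ := hsurj μ
  exact ⟨c, fun b => by rw [← hL, hc]⟩

/-- A `k`-linear functional `μ` on `M` gives an `A`-linear map from `I M` to `A`. -/
theorem exists_extension {l : A →ₗ[k] k} (hl : ∀ c : A, (∀ b : A, l (b * c) = 0) → c = 0)
    (M : ModuleCat.{u} A) (μ : M →+ k) (hμ : ∀ (c : k) (m : M), μ (algebraMap k A c • m) = c * μ m) :
    ∃ e : (inj k A).obj M →ₗ[A] A, ∀ φ b, l (b * e φ) = μ (injEval k M φ b) := by
  have h : ∀ φ : (inj k A).obj M, ∃ c : A, ∀ b, l (b * c) = μ (injEval k M φ b) := fun φ =>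
    form_surjective k hl
      { toFun := fun b => μ (injEval k M φ b)
        map_add' := fun b b' => by rw [injEval_add_right, map_add]
        map_smul' := fun c b => by rw [injEval_smul_right, hμ]; rfl }
  choose e he using h
  have huniq : ∀ c c' : A, (∀ b, l (b * c) = l (b * c')) → c = c' := fun c c' h =>
    sub_eq_zero.1 (hl _ fun b => by rw [mul_sub, map_sub, h, sub_self])
  refine ⟨{ toFun := e, map_add' := fun φ φ' => huniq _ _ fun b => ?_,
            map_smul' := fun a φ => huniq _ _ fun b => ?_ }, he⟩
  · rw [he, mul_add, map_add, he, he, ← map_add]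
    rfl
  · rw [he, injEval_smul, RingHom.id_apply, smul_eq_mul, ← mul_assoc, he]

variable [HasFrobeniusForm k A]

theorem exists_inj_equiv (M : ModuleCat.{u} A) [Module.Finite A M] :
    ∃ n : ℕ, Nonempty ((inj k A).obj M ≃ₗ[A] (Fin n → A)) := by
  let _ : Module k M := Module.compHom M (algebraMap k A)
  have hs : ∀ (c : k) (m : M), c • m = algebraMap k A c • m := fun _ _ => rfl
  have : IsScalarTower k A M := ⟨fun c a m => by rw [Algebra.smul_def, mul_smul, hs]⟩
  have : Module.Finite k M := Module.Finite.trans A M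
  obtain ⟨l, hl⟩ := HasFrobeniusForm.exists_form (k := k) (A := A)
  let v := Module.finBasis k M
  have h := fun j => exists_extension k hl M (v.coord j).toAddMonoidHom (fun c m => by
    rw [← hs]; exact map_smul (v.coord j) c m)
  choose e he using h
  refine ⟨_, ⟨LinearEquiv.ofBijective (LinearMap.pi e) ⟨?_, ?_⟩⟩⟩
  · rw [← LinearMap.ker_eq_bot, LinearMap.ker_eq_bot']
    intro φ hφ
    apply injEval_ext
    intro b
    change _ = injEval k M 0 b
    have h0 : injEval k M 0 b = 0 := rfl
    rw [h0]
    apply v.ext_elem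
    intro j
    have := he j φ b
    rw [show e j φ = 0 from congrFun hφ j, mul_zero, map_zero] at this
    rw [map_zero]
    exact this.symm
  · intro c
    let F : A → M := fun b => ∑ j, l (b * c j) • v j
    have hF : ∀ b b', F (b + b') = F b + F b' := fun b b' => by
      simp only [F, ← Finset.sum_add_distrib, ← add_smul, ← map_add, add_mul]
    have hF' : ∀ (t : k) (b : A), F (algebraMap k A t * b) = algebraMap k A t • F b := fun t b => by
      simp only [F, ← hs, Finset.smul_sum, smul_smul, ← Algebra.smul_def, smul_mul_assoc, map_smul,
        smul_eq_mul]
    let φ : (inj k A).obj M := (ModuleCat.CoextendScalars.equiv (algebraMap k A) _).symm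
      { toFun := F
        map_add' := hF
        map_smul' := hF' }
    have hφ : ∀ b, injEval k M φ b = ∑ j, l (b * c j) • v j := fun b => rfl
    refine ⟨φ, funext fun j => sub_eq_zero.1 (hl _ fun b => ?_)⟩
    rw [mul_sub, map_sub, LinearMap.pi_apply, he, hφ, sub_eq_zero]
    change v.coord j _ = _
    simp [Finsupp.single_apply]

instance finite_inj (M : ModuleCat.{u} A) [Module.Finite A M] :
    Module.Finite A ((inj k A).obj M) := by
  obtain ⟨n, ⟨e⟩⟩ := exists_inj_equiv k M
  exact Module.Finite.equiv e.symm

theorem projective_inj (M : ModuleCat.{u} A) [Module.Finite A M] :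
    Module.Projective A ((inj k A).obj M) := by
  obtain ⟨n, ⟨e⟩⟩ := exists_inj_equiv k M
  exact Module.Projective.of_equiv e.symm

/-- The embedding of a finitely generated projective module `P` into `I P` splits. -/
theorem exists_retraction (P : ModuleCat.{u} A) [Module.Finite A P] [Module.Projective A P] :
    ∃ r : (inj k A).obj P →ₗ[A] P, ∀ x, r ((toInj k A).app P x) = x := by
  obtain ⟨l, hl⟩ := HasFrobeniusForm.exists_form (k := k) (A := A)
  obtain ⟨n, p, s, -, -, hps⟩ := Module.Finite.exists_comp_eq_id_of_projective A P
  have h := fun j => exists_extension k hl P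
    (l.toAddMonoidHom.comp ((LinearMap.proj j).comp s).toAddMonoidHom) (fun c m => by
      change l (s (algebraMap k A c • m) j) = c * l (s m j)
      rw [map_smul, Pi.smul_apply, algebraMap_smul, map_smul, smul_eq_mul])
  choose e he using h
  refine ⟨p.comp (LinearMap.pi e), fun x => ?_⟩
  have hx : LinearMap.pi e ((toInj k A).app P x) = s x := funext fun j =>
    sub_eq_zero.1 (hl _ fun b => by
      rw [mul_sub, map_sub, LinearMap.pi_apply, he, injEval_toInj, sub_eq_zero]
      change l (s (b • x) j) = _
      rw [map_smul]
      rfl)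
  rw [LinearMap.comp_apply, hx, ← LinearMap.comp_apply, hps]
  rfl

/-- The module `Σ M = I M / M`. -/
noncomputable abbrev suspObj (M : FGModuleCat.{u} A) : FGModuleCat.{u} A :=
  FGModuleCat.of A ((inj k A).obj M.obj ⧸ LinearMap.range ((toInj k A).app M.obj).hom)

/-- The map `Σ M ⟶ Σ N` induced by a map `M ⟶ N`. -/
noncomputable abbrev suspMap {M N : FGModuleCat.{u} A} (f : M ⟶ N) : suspObj k M ⟶ suspObj k N :=
  FGModuleCat.ofHom (Submodule.mapQ _ _ ((inj k A).map f.hom).hom (by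
    rintro _ ⟨m, rfl⟩
    refine ⟨f.hom m, ?_⟩
    exact ConcreteCategory.congr_hom ((toInj k A).naturality f.hom) m))

/-- The cosyzygy functor on finitely generated modules. -/
noncomputable def suspFunctor : FGModuleCat.{u} A ⥤ FGModuleCat.{u} A where
  obj M := suspObj k M
  map f := suspMap k f
  map_id M := by
    ext x
    change Submodule.mkQ _ ((inj k A).map (𝟙 M.obj) x) = _
    rw [CategoryTheory.Functor.map_id]
    rfl
  map_comp {M N L} f g := by
    ext x
    change Submodule.mkQ _ ((inj k A).map (f.hom ≫ g.hom) x) = _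
    rw [CategoryTheory.Functor.map_comp]
    rfl

theorem suspMap_sub {M N : FGModuleCat.{u} A} (f g : M ⟶ N) :
    suspMap k (f - g) = suspMap k f - suspMap k g := by
  ext x
  let π := Submodule.mkQ (LinearMap.range ((toInj k A).app N.obj).hom)
  change π ((inj k A).map (f - g).hom x) = π ((inj k A).map f.hom x) - π ((inj k A).map g.hom x)
  rw [← map_sub]
  rfl

theorem projective_suspObj (P : FGModuleCat.{u} A) (hP : Module.Projective A P) :
    Module.Projective A (suspObj k P) := by
  have := projective_inj k P.obj
  have : Module.Projective A P.obj := hP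
  have : Module.Finite A P.obj := P.property
  obtain ⟨r, hr⟩ := exists_retraction k P.obj
  let i := ((toInj k A).app P.obj).hom
  let s : ((inj k A).obj P.obj ⧸ LinearMap.range i) →ₗ[A] (inj k A).obj P.obj :=
    Submodule.liftQ _ (LinearMap.id - i.comp r) (by
      rintro _ ⟨x, rfl⟩
      rw [LinearMap.mem_ker, LinearMap.sub_apply, LinearMap.comp_apply, LinearMap.id_apply,
        sub_eq_zero]
      exact congrArg i (hr x).symm)
  refine Module.Projective.of_split s (Submodule.mkQ _) ?_
  ext x
  change Submodule.mkQ _ (x - i (r x)) = Submodule.mkQ _ x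
  rw [map_sub, sub_eq_self]
  exact (Submodule.Quotient.mk_eq_zero _).2 ⟨_, rfl⟩

/-- The suspension of the stable category, `M ↦ Σ M = Hom_k(A, M) / M`, the cokernel of the
embedding of `M` into an injective module. -/
noncomputable def suspension : StableModCat A ⥤ StableModCat A :=
  CategoryTheory.Quotient.lift _ (suspFunctor k ⋙ proj A) (by
    rintro M N f g ⟨P, hP, a, b, h⟩
    refine CategoryTheory.Quotient.sound _ ⟨suspObj k P, projective_suspObj k P hP,
      (suspFunctor k).map a, (suspFunctor k).map b, ?_⟩
    refine (suspMap_sub k f g).symm.trans ?_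
    rw [h]
    exact (suspFunctor k).map_comp a b)

section

variable {M N : FGModuleCat.{u} A} (f : M ⟶ N)

/-- The submodule `{(i m, -f m)}` of `I M × N`, where `i` is the embedding of `M` into `I M`. -/
noncomputable def coneRel : Submodule A ((inj k A).obj M.obj × N) :=
  LinearMap.range (((toInj k A).app M.obj).hom.prod (-f.hom.hom))

/-- The pushout `C_f = (I M × N) / {(i m, -f m)}` of `f : M ⟶ N` and the embedding `M ⟶ I M`. -/
noncomputable def cone : FGModuleCat.{u} A :=
  FGModuleCat.of A (((inj k A).obj M.obj × N) ⧸ coneRel k f)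

/-- The map `N ⟶ C_f` into the pushout. -/
noncomputable def coneInr : N ⟶ cone k f :=
  FGModuleCat.ofHom ((coneRel k f).mkQ.comp (LinearMap.inr A _ _))

/-- The map `C_f ⟶ Σ M` of cokernels induced by `I M ⟶ I M / M` and `0 : N ⟶ I M / M`. -/
noncomputable def coneFst : cone k f ⟶ (suspFunctor k).obj M :=
  FGModuleCat.ofHom (Submodule.mapQ _ _ (LinearMap.fst A _ _) (by
    rintro _ ⟨m, rfl⟩
    exact ⟨m, rfl⟩))

/-- The standard triangle `M ⟶ N ⟶ C_f ⟶ Σ M` of a map `f : M ⟶ N` of finitely generated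
modules. -/
noncomputable def standardTriangle : SuspTriangle (suspension k (A := A)) where
  X := (proj A).obj M
  Y := (proj A).obj N
  Z := (proj A).obj (cone k f)
  f := (proj A).map f
  g := (proj A).map (coneInr k f)
  h := (proj A).map (coneFst k f)

end

/-- The distinguished triangles of the stable category: those isomorphic to a standard triangle. -/
def Distinguished (t : SuspTriangle (suspension k (A := A))) : Prop :=
  ∃ (M N : FGModuleCat.{u} A) (f : M ⟶ N), t.Isomorphic (standardTriangle k f)

end

end StableModCat

/-! ### Twisted modules and reduction modulo a central element -/

/-- The property of being a finitely generated free module. -/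
def isFiniteFree (R : Type u) [Ring R] : ObjectProperty (ModuleCat.{u} R) :=
  fun M => Module.Free R M ∧ Module.Finite R M

/-- The category of finitely generated free left `R`-modules. -/
abbrev FreeModCat (R : Type u) [Ring R] := (isFiniteFree R).FullSubcategory

instance FreeModCat.hasBinaryBiproducts (R : Type u) [Ring R] :
    HasBinaryBiproducts (FreeModCat R) where
  has_binary_biproduct M N := by
    have hM := M.property.1
    have hN := N.property.1
    have hM' := M.property.2
    have hN' := N.property.2
    exact ⟨⟨⟨{
        pt := ⟨ModuleCat.of R (M.obj × N.obj), ⟨inferInstanceAs (Module.Free R (M.obj × N.obj)),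
          inferInstanceAs (Module.Finite R (M.obj × N.obj))⟩⟩
        fst := ObjectProperty.homMk (ModuleCat.ofHom (LinearMap.fst R M.obj N.obj))
        snd := ObjectProperty.homMk (ModuleCat.ofHom (LinearMap.snd R M.obj N.obj))
        inl := ObjectProperty.homMk (ModuleCat.ofHom (LinearMap.inl R M.obj N.obj))
        inr := ObjectProperty.homMk (ModuleCat.ofHom (LinearMap.inr R M.obj N.obj))
        inl_fst := rfl
        inl_snd := rfl
        inr_fst := rfl
        inr_snd := rfl },
      isBinaryBilimitOfTotal _ (by
        apply ObjectProperty.hom_ext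
        apply ModuleCat.hom_ext
        apply LinearMap.ext
        intro x
        exact Prod.fst_add_snd x)⟩⟩⟩

/-- A ring `B` with an automorphism `ν` and a central element `w` such that `ν` fixes the elements
of the ideal `(w)`. -/
structure TwistDatum (B : Type u) [Ring B] where
  ν : B ≃+* B
  w : B
  central : ∀ b, b * w = w * b
  fixed : ∀ b, ν (b * w) = b * w

namespace TwistDatum

section

variable {B : Type u} [Ring B] (D : TwistDatum B)

/-- The twisted module `_ν M`: the group `M`, on which `b` acts as `ν b` acts on `M`. -/
def Twisted (_ : TwistDatum B) (M : Type u) : Type u := M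

instance (M : Type u) [AddCommGroup M] : AddCommGroup (D.Twisted M) :=
  inferInstanceAs (AddCommGroup M)

instance (M : Type u) [AddCommGroup M] [Module B M] : Module B (D.Twisted M) :=
  Module.compHom M (D.ν : B →+* B)

/-- The identity map from `M` to `_ν M`. -/
def toTwisted (M : Type u) [AddCommGroup M] : M ≃+ D.Twisted M := AddEquiv.refl M

theorem smul_toTwisted {M : Type u} [AddCommGroup M] [Module B M] (b : B) (m : M) :
    b • D.toTwisted M m = D.toTwisted M (D.ν b • m) := rfl

theorem w_mul (b : B) : D.w * b = D.ν b * D.w := by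
  have h : D.ν D.w = D.w := by simpa using D.fixed 1
  conv_rhs => rw [← h, ← map_mul, D.fixed]
  exact (D.central b).symm

instance (M : Type u) [AddCommGroup M] [Module B M] [Module.Free B M] :
    Module.Free B (D.Twisted M) := by
  have := RingHomInvPair.of_ringEquiv D.ν
  have := RingHomInvPair.of_ringEquiv_symm D.ν
  let e : D.Twisted M ≃ₛₗ[(D.ν : B →+* B)] M :=
    { (D.toTwisted M).symm with map_smul' := fun _ _ => rfl }
  exact Module.Free.of_equiv e.symm

instance (M : Type u) [AddCommGroup M] [Module B M] [Module.Finite B M] :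
    Module.Finite B (D.Twisted M) := by
  have := RingHomInvPair.of_ringEquiv D.ν
  have := RingHomInvPair.of_ringEquiv_symm D.ν
  let e : D.Twisted M ≃ₛₗ[(D.ν : B →+* B)] M :=
    { (D.toTwisted M).symm with map_smul' := fun _ _ => rfl }
  exact Module.Finite.of_surjective e.symm.toLinearMap e.symm.surjective

/-- A `B`-linear map `M ⟶ N`, viewed as a map `_ν M ⟶ _ν N`. -/
def twistMap {M N : Type u} [AddCommGroup M] [Module B M] [AddCommGroup N] [Module B N]
    (f : M →ₗ[B] N) : D.Twisted M →ₗ[B] D.Twisted N where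
  toFun m := D.toTwisted N (f ((D.toTwisted M).symm m))
  map_add' := map_add f
  map_smul' b := f.map_smul (D.ν b)

/-- The multiplication map `M ⟶ _ν M`, `m ↦ w m`. -/
def mulW (M : Type u) [AddCommGroup M] [Module B M] : M →ₗ[B] D.Twisted M where
  toFun m := D.toTwisted M (D.w • m)
  map_add' m m' := by rw [smul_add, map_add]
  map_smul' b m := by
    rw [RingHom.id_apply, smul_toTwisted, smul_smul, smul_smul, w_mul]

theorem mulW_twisted (M : Type u) [AddCommGroup M] [Module B M] :
    D.mulW (D.Twisted M) = D.twistMap (D.mulW M) := by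
  ext m
  have h : D.ν D.w = D.w := by simpa using D.fixed 1
  change D.ν D.w • (D.toTwisted M).symm m = D.w • (D.toTwisted M).symm m
  rw [h]

/-- The twisting functor `S_ν` on finitely generated free left `B`-modules, `M ↦ _ν M`. It is the
identity on the underlying maps. -/
noncomputable def twist : FreeModCat B ⥤ FreeModCat B where
  obj M := ⟨ModuleCat.of B (D.Twisted M.obj), by
    have := M.property.1
    have := M.property.2
    exact ⟨inferInstanceAs (Module.Free B (D.Twisted M.obj)),
      inferInstanceAs (Module.Finite B (D.Twisted M.obj))⟩⟩
  map f := ObjectProperty.homMk (ModuleCat.ofHom (D.twistMap f.hom.hom))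
  map_id _ := rfl
  map_comp _ _ := rfl

instance : D.twist.Additive where
  map_add := rfl

/-- The natural transformation `η_w : 1 ⟶ S_ν` with coordinates `m ↦ w m`, a central element. -/
noncomputable def eta : CentralElement D.twist where
  η :=
    { app := fun M => ObjectProperty.homMk (ModuleCat.ofHom (D.mulW M.obj))
      naturality := fun M N f => by
        apply ObjectProperty.hom_ext
        apply ModuleCat.hom_ext
        apply LinearMap.ext
        intro m
        exact (f.hom.hom.map_smul D.w m).symm }
  comm M := congrArg (fun f => ObjectProperty.homMk (ModuleCat.ofHom f)) (D.mulW_twisted M.obj)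

instance : (Ideal.span {D.w}).IsTwoSided where
  mul_mem_of_left {a} b ha := by
    obtain ⟨c, rfl⟩ := Ideal.mem_span_singleton'.1 ha
    rw [mul_assoc, ← D.central, ← mul_assoc]
    exact Ideal.mem_span_singleton'.2 ⟨_, rfl⟩

/-- The factor ring `A = B/(w)`. -/
abbrev quot : Type u := B ⧸ Ideal.span {D.w}

/-- The submodule `w M = (w) M` of a `B`-module `M`. -/
abbrev wSub (M : Type u) [AddCommGroup M] [Module B M] : Submodule B M :=
  Ideal.span {D.w} • (⊤ : Submodule B M)

/-- The `A`-linear map `M/wM ⟶ N/wN` induced by a `B`-linear map `M ⟶ N`. -/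
def redMap {M N : Type u} [AddCommGroup M] [Module B M] [AddCommGroup N] [Module B N]
    (f : M →ₗ[B] N) : (M ⧸ D.wSub M) →ₗ[D.quot] (N ⧸ D.wSub N) where
  toFun := Submodule.mapQ (D.wSub M) (D.wSub N) f (by
    rw [← Submodule.map_le_iff_le_comap, Submodule.map_smul'']
    exact Submodule.smul_mono le_rfl le_top)
  map_add' := map_add _
  map_smul' a m := by
    obtain ⟨b, rfl⟩ := Ideal.Quotient.mk_surjective a
    obtain ⟨m, rfl⟩ := Submodule.Quotient.mk_surjective _ m
    exact congrArg Submodule.Quotient.mk (f.map_smul b m)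

instance (M : Type u) [AddCommGroup M] [Module B M] [Module.Finite B M] :
    Module.Finite D.quot (M ⧸ D.wSub M) := by
  let f : M →ₛₗ[Ideal.Quotient.mk (Ideal.span {D.w})] (M ⧸ D.wSub M) :=
    { toFun := Submodule.Quotient.mk
      map_add' := fun _ _ => rfl
      map_smul' := fun _ _ => rfl }
  have : RingHomSurjective (Ideal.Quotient.mk (Ideal.span {D.w})) := ⟨Ideal.Quotient.mk_surjective⟩
  exact Module.Finite.of_surjective f (Submodule.Quotient.mk_surjective _)

/-- Reduction modulo `w`, from finitely generated free `B`-modules to finitely generated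
`A`-modules: `M ↦ M/wM`. -/
noncomputable def red : FreeModCat B ⥤ FGModuleCat.{u} D.quot where
  obj M :=
    have : Module.Finite B M.obj := M.property.2
    FGModuleCat.of D.quot (M.obj ⧸ D.wSub M.obj)
  map {M N} f := ObjectProperty.homMk (ModuleCat.ofHom (D.redMap f.hom.hom))
  map_id M := by
    apply ObjectProperty.hom_ext
    apply ModuleCat.hom_ext
    apply LinearMap.ext
    rintro ⟨m⟩
    rfl
  map_comp f g := by
    apply ObjectProperty.hom_ext
    apply ModuleCat.hom_ext
    apply LinearMap.ext
    rintro ⟨m⟩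
    rfl

/-- The functor sending a factorization `(F, G, f, g)` to the image of the reduced map
`F/wF ⟶ G/wG`, and a morphism `(ψ, φ)` of factorizations to the restriction of the reduced map
of `φ` to the images. -/
noncomputable def imageFunctor : Factorization D.eta ⥤ FGModuleCat.{u} D.quot where
  obj X := FGModuleCat.of D.quot (LinearMap.range (D.red.map X.f).hom.hom)
  map {X Y} a := FGModuleCat.ofHom ((D.red.map a.φ).hom.hom.restrict (by
    rintro _ ⟨m, rfl⟩
    refine ⟨D.red.map a.ψ m, ?_⟩
    have := congrArg D.red.map a.comm_f
    rw [D.red.map_comp, D.red.map_comp] at this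
    exact (ConcreteCategory.congr_hom this m).symm))
  map_id X := by
    apply ObjectProperty.hom_ext
    apply ModuleCat.hom_ext
    apply LinearMap.ext
    intro x
    refine Subtype.ext (p := (· ∈ LinearMap.range (D.red.map X.f).hom.hom)) ?_
    change (D.red.map (𝟙 X.N)) x.1 = x.1
    rw [D.red.map_id]
    rfl
  map_comp {X Y Z} a b := by
    apply ObjectProperty.hom_ext
    apply ModuleCat.hom_ext
    apply LinearMap.ext
    intro x
    refine Subtype.ext (p := (· ∈ LinearMap.range (D.red.map Z.f).hom.hom)) ?_
    change (D.red.map (a.φ ≫ b.φ)) x.1 = D.red.map b.φ (D.red.map a.φ x.1)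
    rw [D.red.map_comp]
    rfl

end

end TwistDatum

/-! ### The quantum complete intersection -/

/-- The relations `x² = y² = xyx = yxy = 0` on the free algebra on `x` (index `0`) and `y`
(index `1`). -/
inductive RelB (k : Type u) [Field k] : FreeAlgebra k (Fin 2) → FreeAlgebra k (Fin 2) → Prop
  | xx : RelB k (FreeAlgebra.ι k 0 * FreeAlgebra.ι k 0) 0
  | yy : RelB k (FreeAlgebra.ι k 1 * FreeAlgebra.ι k 1) 0
  | xyx : RelB k (FreeAlgebra.ι k 0 * FreeAlgebra.ι k 1 * FreeAlgebra.ι k 0) 0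
  | yxy : RelB k (FreeAlgebra.ι k 1 * FreeAlgebra.ι k 0 * FreeAlgebra.ι k 1) 0

/-- The algebra `B = k⟨x, y⟩ / (x², y², xyx, yxy)`. -/
abbrev AlgB (k : Type u) [Field k] : Type u := RingQuot (RelB k)

namespace AlgB

section

variable {k : Type u} [Field k]

/-- The generator `x` of `B`. -/
noncomputable def x : AlgB k := RingQuot.mkAlgHom k (RelB k) (FreeAlgebra.ι k 0)

/-- The generator `y` of `B`. -/
noncomputable def y : AlgB k := RingQuot.mkAlgHom k (RelB k) (FreeAlgebra.ι k 1)

theorem x_mul_x : (x * x : AlgB k) = 0 := by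
  rw [x, ← map_mul, RingQuot.mkAlgHom_rel k RelB.xx, map_zero]

theorem y_mul_y : (y * y : AlgB k) = 0 := by
  rw [y, ← map_mul, RingQuot.mkAlgHom_rel k RelB.yy, map_zero]

theorem x_mul_y_mul_x : (x * y * x : AlgB k) = 0 := by
  rw [x, y, ← map_mul, ← map_mul, RingQuot.mkAlgHom_rel k RelB.xyx, map_zero]

theorem y_mul_x_mul_y : (y * x * y : AlgB k) = 0 := by
  rw [x, y, ← map_mul, ← map_mul, RingQuot.mkAlgHom_rel k RelB.yxy, map_zero]

theorem induction {P : AlgB k → Prop} (hc : ∀ c : k, P (algebraMap k _ c)) (hx : P x) (hy : P y)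
    (hm : ∀ a b, P a → P b → P (a * b)) (ha : ∀ a b, P a → P b → P (a + b)) (b : AlgB k) : P b := by
  obtain ⟨b, rfl⟩ := RingQuot.mkAlgHom_surjective k (RelB k) b
  induction b using FreeAlgebra.induction with
  | grade0 c => rw [AlgHom.commutes]; exact hc c
  | grade1 i => fin_cases i; exacts [hx, hy]
  | mul a b h h' => rw [map_mul]; exact hm _ _ h h'
  | add a b h h' => rw [map_add]; exact ha _ _ h h'

/-- The algebra homomorphism out of `B` given by the images of `x` and `y`. -/
noncomputable def lift {R : Type u} [Ring R] [Algebra k R] (a b : R) (h₁ : a * a = 0)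
    (h₂ : b * b = 0) (h₃ : a * b * a = 0) (h₄ : b * a * b = 0) : AlgB k →ₐ[k] R :=
  RingQuot.liftAlgHom k ⟨FreeAlgebra.lift k ![a, b], by rintro _ _ (_ | _ | _ | _) <;> simp [*]⟩

section

variable {R : Type u} [Ring R] [Algebra k R] (a b : R) (h₁ : a * a = 0)
    (h₂ : b * b = 0) (h₃ : a * b * a = 0) (h₄ : b * a * b = 0)

@[simp] theorem lift_x : lift (k := k) a b h₁ h₂ h₃ h₄ x = a := by simp [lift, x]

@[simp] theorem lift_y : lift (k := k) a b h₁ h₂ h₃ h₄ y = b := by simp [lift, y]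

end

theorem algHom_ext {R : Type u} [Ring R] [Algebra k R] {f g : AlgB k →ₐ[k] R} (hx : f x = g x)
    (hy : f y = g y) : f = g := by
  apply RingQuot.ringQuot_ext'
  apply FreeAlgebra.hom_ext
  funext i
  fin_cases i
  exacts [hx, hy]

/-- The endomorphism of `B` with `x ↦ a x` and `y ↦ b y`. -/
noncomputable def scale (a b : k) : AlgB k →ₐ[k] AlgB k :=
  lift (a • x) (b • y) (by simp [x_mul_x]) (by simp [y_mul_y])
    (by simp [x_mul_y_mul_x]) (by simp [y_mul_x_mul_y])

/-- The automorphism `ν` of `B` with `ν x = -q⁻¹ x` and `ν y = -q y`. -/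
noncomputable def nu (q : k) (hq : q ≠ 0) : AlgB k ≃ₐ[k] AlgB k :=
  AlgEquiv.ofAlgHom (scale (-q⁻¹) (-q)) (scale (-q) (-q⁻¹))
    (algHom_ext (by simp [scale, smul_smul, hq]) (by simp [scale, smul_smul, hq]))
    (algHom_ext (by simp [scale, smul_smul, hq]) (by simp [scale, smul_smul, hq]))

theorem nu_x (q : k) (hq : q ≠ 0) : nu q hq x = -q⁻¹ • x := lift_x ..

theorem nu_y (q : k) (hq : q ≠ 0) : nu q hq y = -q • y := lift_y ..

/-- The element `w = xy - qyx` of `B`. -/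
noncomputable def w (q : k) : AlgB k := x * y - q • (y * x)

theorem nu_w (q : k) (hq : q ≠ 0) : nu q hq (w q) = w q := by
  simp [w, nu_x, nu_y, smul_smul, hq]

theorem exists_mul_w (q : k) (b : AlgB k) : ∃ c : k, b * w q = c • w q ∧ w q * b = c • w q := by
  induction b using induction with
  | hc c => exact ⟨c, by rw [Algebra.smul_def], by rw [Algebra.smul_def, Algebra.commutes]⟩
  | hx =>
    refine ⟨0, ?_, ?_⟩
    · rw [w, mul_sub, mul_smul_comm, ← mul_assoc, ← mul_assoc, x_mul_x, x_mul_y_mul_x]; simp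
    · rw [w, sub_mul, smul_mul_assoc, x_mul_y_mul_x, mul_assoc, x_mul_x]; simp
  | hy =>
    refine ⟨0, ?_, ?_⟩
    · rw [w, mul_sub, mul_smul_comm, ← mul_assoc, ← mul_assoc, y_mul_y, y_mul_x_mul_y]; simp
    · rw [w, sub_mul, smul_mul_assoc, y_mul_x_mul_y, mul_assoc, y_mul_y]; simp
  | hm a b h h' =>
    obtain ⟨c, h₁, h₂⟩ := h
    obtain ⟨c', h₁', h₂'⟩ := h'
    refine ⟨c * c', ?_, ?_⟩
    · rw [mul_assoc, h₁', mul_smul_comm, h₁, smul_smul, mul_comm]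
    · rw [← mul_assoc, h₂, smul_mul_assoc, h₂', smul_smul]
  | ha a b h h' =>
    obtain ⟨c, h₁, h₂⟩ := h
    obtain ⟨c', h₁', h₂'⟩ := h'
    exact ⟨c + c', by rw [add_mul, h₁, h₁', add_smul], by rw [mul_add, h₂, h₂', add_smul]⟩

/-- The automorphism `ν` and the element `w` of `B`. -/
noncomputable def datum (q : k) (hq : q ≠ 0) : TwistDatum (AlgB k) where
  ν := (nu q hq).toRingEquiv
  w := w q
  central b := by
    obtain ⟨c, h, h'⟩ := exists_mul_w q b
    rw [h, h']
  fixed b := by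
    obtain ⟨c, h, -⟩ := exists_mul_w q b
    rw [h]
    exact (map_smul (nu q hq) c (w q)).trans (by rw [nu_w])

end

end AlgB

/-- The quantum complete intersection `A = B/(w) = k⟨x, y⟩ / (x², xy - qyx, y²)`. -/
abbrev AlgA {k : Type u} [Field k] (q : k) (hq : q ≠ 0) : Type u := (AlgB.datum q hq).quot

namespace AlgA

section

variable {k : Type u} [Field k] (q : k) (hq : q ≠ 0)

/-- The residue class map `B ⟶ A`. -/
noncomputable def mk : AlgB k →ₐ[k] AlgA q hq :=
  Ideal.Quotient.mkₐ k (Ideal.span {(AlgB.datum q hq).w})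

theorem mk_xy : mk q hq AlgB.x * mk q hq AlgB.y = q • (mk q hq AlgB.y * mk q hq AlgB.x) := by
  rw [← map_mul, ← map_mul, ← map_smul, ← sub_eq_zero, ← map_sub]
  exact Ideal.Quotient.eq_zero_iff_mem.2 (Ideal.subset_span rfl)

/-- The elements `1, x, y, yx` span `A`. -/
theorem exists_coeff (a : AlgA q hq) : ∃ c : Fin 4 → k, a = c 0 • 1 + c 1 • mk q hq AlgB.x +
    c 2 • mk q hq AlgB.y + c 3 • (mk q hq AlgB.y * mk q hq AlgB.x) := by
  obtain ⟨b, rfl⟩ := Ideal.Quotient.mkₐ_surjective k _ a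
  change ∃ c : Fin 4 → k, mk q hq b = _
  have hxx : mk q hq AlgB.x * mk q hq AlgB.x = 0 := by rw [← map_mul, AlgB.x_mul_x, map_zero]
  have hyy : mk q hq AlgB.y * mk q hq AlgB.y = 0 := by rw [← map_mul, AlgB.y_mul_y, map_zero]
  have hxy := mk_xy q hq
  have hxyx : mk q hq AlgB.x * (mk q hq AlgB.y * mk q hq AlgB.x) = 0 := by
    rw [← mul_assoc, ← map_mul, ← map_mul, AlgB.x_mul_y_mul_x, map_zero]
  have hyyx : mk q hq AlgB.y * (mk q hq AlgB.y * mk q hq AlgB.x) = 0 := by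
    rw [← mul_assoc, hyy, zero_mul]
  have hyxx : mk q hq AlgB.y * mk q hq AlgB.x * mk q hq AlgB.x = 0 := by
    rw [mul_assoc, hxx, mul_zero]
  have hyxy : mk q hq AlgB.y * mk q hq AlgB.x * mk q hq AlgB.y = 0 := by
    rw [← map_mul, ← map_mul, AlgB.y_mul_x_mul_y, map_zero]
  have hyxyx : mk q hq AlgB.y * mk q hq AlgB.x * (mk q hq AlgB.y * mk q hq AlgB.x) = 0 := by
    rw [← mul_assoc, hyxy, zero_mul]
  induction b using AlgB.induction with
  | hc c => exact ⟨![c, 0, 0, 0], by simp [Algebra.algebraMap_eq_smul_one]⟩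
  | hx => exact ⟨![0, 1, 0, 0], by simp⟩
  | hy => exact ⟨![0, 0, 1, 0], by simp⟩
  | hm a b h h' =>
    obtain ⟨c, h⟩ := h
    obtain ⟨d, h'⟩ := h'
    refine ⟨![c 0 * d 0, c 0 * d 1 + c 1 * d 0, c 0 * d 2 + c 2 * d 0,
      c 0 * d 3 + c 3 * d 0 + c 2 * d 1 + q * (c 1 * d 2)], ?_⟩
    rw [map_mul, h, h']
    simp only [add_mul, mul_add, smul_mul_assoc, mul_smul_comm, smul_smul, one_mul, mul_one, hxx,
      hyy, hxy, hxyx, hyyx, hyxx, hyxy, hyxyx, smul_zero, add_zero]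
    simp only [Matrix.cons_val]
    module
  | ha a b h h' =>
    obtain ⟨c, h⟩ := h
    obtain ⟨d, h'⟩ := h'
    refine ⟨c + d, ?_⟩
    rw [map_add, h, h']
    simp only [Pi.add_apply]
    module

instance : Module.Finite k (AlgA q hq) := by
  classical
  refine ⟨⟨{1, mk q hq AlgB.x, mk q hq AlgB.y, mk q hq AlgB.y * mk q hq AlgB.x}, ?_⟩⟩
  rw [eq_top_iff]
  rintro a -
  obtain ⟨c, rfl⟩ := exists_coeff q hq a
  refine add_mem (add_mem (add_mem ?_ ?_) ?_) ?_ <;>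
    exact Submodule.smul_mem _ _ (Submodule.subset_span (by simp))

/-- The representation of `B` on `A` by left multiplication, with respect to the basis
`1, x, y, yx` of `A`. -/
noncomputable def rep : AlgB k →ₐ[k] Matrix (Fin 4) (Fin 4) k :=
  AlgB.lift !![0, 0, 0, 0; 1, 0, 0, 0; 0, 0, 0, 0; 0, 0, q, 0]
    !![0, 0, 0, 0; 0, 0, 0, 0; 1, 0, 0, 0; 0, 1, 0, 0]
    (by ext i j; fin_cases i <;> fin_cases j <;> simp [Matrix.mul_apply, Fin.sum_univ_four])
    (by ext i j; fin_cases i <;> fin_cases j <;> simp [Matrix.mul_apply, Fin.sum_univ_four])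
    (by ext i j; fin_cases i <;> fin_cases j <;> simp [Matrix.mul_apply, Fin.sum_univ_four])
    (by ext i j; fin_cases i <;> fin_cases j <;> simp [Matrix.mul_apply, Fin.sum_univ_four])

theorem rep_w : rep q (AlgB.w q) = 0 := by
  ext i j
  fin_cases i <;> fin_cases j <;>
    simp [rep, AlgB.w]

/-- The linear functional on `A` taking the coefficient of `yx`. -/
noncomputable def form : AlgA q hq →ₗ[k] k where
  toFun := fun a => Ideal.Quotient.lift (Ideal.span {(AlgB.datum q hq).w})
    (rep q : AlgB k →+* Matrix (Fin 4) (Fin 4) k) (fun b hb => by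
      obtain ⟨c, rfl⟩ := Ideal.mem_span_singleton'.1 hb
      rw [map_mul]
      exact (congrArg _ (rep_w q)).trans (mul_zero _)) a 3 0
  map_add' a b := by rw [map_add]; rfl
  map_smul' c a := by
    obtain ⟨b, rfl⟩ := Ideal.Quotient.mk_surjective a
    change rep q (c • b) 3 0 = c • rep q b 3 0
    rw [map_smul]
    rfl

theorem form_mk (b : AlgB k) : form q hq (mk q hq b) = rep q b 3 0 := rfl

instance : HasFrobeniusForm k (AlgA q hq) := by
  refine ⟨form q hq, fun c h => ?_⟩
  obtain ⟨c, rfl⟩ := exists_coeff q hq c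
  have e : c 0 • 1 + c 1 • mk q hq AlgB.x + c 2 • mk q hq AlgB.y +
      c 3 • (mk q hq AlgB.y * mk q hq AlgB.x) = mk q hq (c 0 • 1 + c 1 • AlgB.x + c 2 • AlgB.y +
      c 3 • (AlgB.y * AlgB.x)) := by simp only [map_add, map_smul, map_mul, map_one]
  rw [e] at h ⊢
  have h' : ∀ b : AlgB k, rep q (b * (c 0 • 1 + c 1 • AlgB.x + c 2 • AlgB.y +
      c 3 • (AlgB.y * AlgB.x))) 3 0 = 0 := fun b => by
    rw [← form_mk q hq, map_mul]
    exact h (mk q hq b)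
  have h₃ := h' 1
  have h₂ := h' AlgB.x
  have h₁ := h' AlgB.y
  have h₀ := h' (AlgB.y * AlgB.x)
  simp [rep, Matrix.mul_apply, Fin.sum_univ_four, hq] at h₀ h₁ h₂ h₃
  simp [h₀, h₁, h₂, h₃]

end

end AlgA

/-! Write a bar for reduction modulo `w`. Everything rests on exactness of a reduced factorization
at the middle term: ker ḡ = im f̄. The inclusion im f̄ ⊆ ker ḡ is formal, and it already makes im f̄
a homotopy invariant in the stable category.

If `w` were a nonzerodivisor on free modules, the other inclusion would be immediate: g n = w h = g
(f h) gives w (n - f h) = f (g (n - f h)) = 0, so n = f h. Here `w` kills the radical, and this only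
shows that n - f h lies in the radical. The rest comes from the shape of `B`: it has basis 1, x, y,
xy, yx, so xB ∩ yB = 0 and every equation between an x-multiple and a y-multiple splits into two.
Together with the annihilators of x, y, xy and yx this yields `exists_eq_add_w_smul`, and hence
`mem_range_red_of_red_eq_zero`.

Given exactness, Ḡ / im f̄ is the image of the suspended factorization (`isPushout_suspImage`), and
the image of a mapping cone is the pushout of im f̄₁ ↪ Ḡ₁ along the induced map
(`isPushout_image_cone`). The modules Ḡ are projective, and projectives over the Frobenius algebra
`A` are injective relative to finitely generated modules. So using Ḡ₁ in place of I(im f̄₁) changes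
cokernels and pushouts only up to stable isomorphism (`exists_isIso_of_isPushout`). One extension Ḡ₁
→ I(im f̄₁) serves both comparisons, which makes the squares of the triangle commute. -/

namespace AlgB

/-! ### The basis 1, x, y, xy, yx of `B` and annihilators in `B`. -/

section

variable {k : Type u} [Field k]

/-- The representation of `B` on itself by left multiplication, with respect to the basis
`1, x, y, xy, yx`. -/
noncomputable def regularRep : AlgB k →ₐ[k] Matrix (Fin 5) (Fin 5) k :=
  lift !![0, 0, 0, 0, 0; 1, 0, 0, 0, 0; 0, 0, 0, 0, 0; 0, 0, 1, 0, 0; 0, 0, 0, 0, 0]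
    !![0, 0, 0, 0, 0; 0, 0, 0, 0, 0; 1, 0, 0, 0, 0; 0, 0, 0, 0, 0; 0, 1, 0, 0, 0]
    (by ext i j; fin_cases i <;> fin_cases j <;> simp [Matrix.mul_apply, Fin.sum_univ_five])
    (by ext i j; fin_cases i <;> fin_cases j <;> simp [Matrix.mul_apply, Fin.sum_univ_five])
    (by ext i j; fin_cases i <;> fin_cases j <;> simp [Matrix.mul_apply, Fin.sum_univ_five])
    (by ext i j; fin_cases i <;> fin_cases j <;> simp [Matrix.mul_apply, Fin.sum_univ_five])

/-- The element of `B` with given coefficients with respect to `1, x, y, xy, yx`. -/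
noncomputable def ofCoeff (c : Fin 5 → k) : AlgB k :=
  c 0 • 1 + c 1 • x + c 2 • y + c 3 • (x * y) + c 4 • (y * x)

theorem x_mul_ofCoeff (c : Fin 5 → k) : x * ofCoeff c = ofCoeff ![0, c 0, 0, c 2, 0] := by
  have h : x * (y * x) = (0 : AlgB k) := by rw [← mul_assoc, x_mul_y_mul_x]
  have h' : x * (x * y) = (0 : AlgB k) := by rw [← mul_assoc, x_mul_x, zero_mul]
  simp [ofCoeff, mul_add, x_mul_x, h, h']

theorem y_mul_ofCoeff (c : Fin 5 → k) : y * ofCoeff c = ofCoeff ![0, 0, c 0, 0, c 1] := by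
  have h : y * (x * y) = (0 : AlgB k) := by rw [← mul_assoc, y_mul_x_mul_y]
  have h' : y * (y * x) = (0 : AlgB k) := by rw [← mul_assoc, y_mul_y, zero_mul]
  simp [ofCoeff, mul_add, y_mul_y, h, h']

theorem exists_eq_ofCoeff (b : AlgB k) : ∃ c, b = ofCoeff c := by
  -- Stability of the span under left multiplication by `b` passes to products in `b`, which
  -- membership of `b` in the span does not do directly. Applying it to the unit recovers `b`.
  suffices h : ∀ c, ∃ d, b * ofCoeff c = ofCoeff d by
    obtain ⟨d, hd⟩ := h ![1, 0, 0, 0, 0]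
    exact ⟨d, by rw [← hd]; simp [ofCoeff]⟩
  induction b using induction with
  | hc t => exact fun c => ⟨t • c, by simp [ofCoeff, ← Algebra.smul_def, smul_smul]⟩
  | hx => exact fun c => ⟨_, x_mul_ofCoeff c⟩
  | hy => exact fun c => ⟨_, y_mul_ofCoeff c⟩
  | hm a b h h' =>
    intro c
    obtain ⟨d, hd⟩ := h' c
    obtain ⟨e, he⟩ := h d
    exact ⟨e, by rw [mul_assoc, hd, he]⟩
  | ha a b h h' =>
    intro c
    obtain ⟨d, hd⟩ := h c
    obtain ⟨e, he⟩ := h' c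
    exact ⟨d + e, by rw [add_mul, hd, he]; simp only [ofCoeff, Pi.add_apply]; module⟩

/-- Column 0 of the regular representation is the action on the basis vector 1, so it reads off the
coefficients. This is what rules out further relations in `B`. -/
theorem ofCoeff_injective : Function.Injective (ofCoeff (k := k)) := by
  have h : ∀ (c : Fin 5 → k) (i : Fin 5), regularRep (ofCoeff c) i 0 = c i := by
    intro c i
    fin_cases i <;> simp [regularRep, ofCoeff]
  intro c d hcd
  ext i
  rw [← h c, ← h d, hcd]

theorem ofCoeff_zero : ofCoeff (0 : Fin 5 → k) = 0 := by simp [ofCoeff]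

theorem ofCoeff_eq_zero_iff {c : Fin 5 → k} : ofCoeff c = 0 ↔ c = 0 :=
  ⟨fun h => ofCoeff_injective (h.trans ofCoeff_zero.symm), fun h => h ▸ ofCoeff_zero⟩

/-- xB has basis x, xy and yB has basis y, yx, so xB ∩ yB = 0. This splitting is the main tool of
the exactness argument. -/
theorem x_mul_eq_zero_of_eq_y_mul {a b : AlgB k} (h : x * a = y * b) : x * a = 0 := by
  obtain ⟨c, rfl⟩ := exists_eq_ofCoeff a
  obtain ⟨d, rfl⟩ := exists_eq_ofCoeff b
  rw [x_mul_ofCoeff, y_mul_ofCoeff] at h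
  have h := ofCoeff_injective h
  rw [x_mul_ofCoeff, ofCoeff_eq_zero_iff]
  have h₁ := congrFun h 1
  have h₃ := congrFun h 3
  simp at h₁ h₃
  simp [h₁, h₃]

theorem ofCoeff_eq_of_zero {c : Fin 5 → k} (h : c 0 = 0) :
    ofCoeff c = x * (c 1 • 1 + c 3 • y) + y * (c 2 • 1 + c 4 • x) := by
  simp [ofCoeff, h, mul_add]
  abel

/-- xyb is xy times the constant coefficient of `b`, so its vanishing puts `b` in the radical xB +
yB. -/
theorem exists_of_x_mul_y_mul {b : AlgB k} (h : x * (y * b) = 0) :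
    ∃ a a', b = x * a + y * a' := by
  obtain ⟨c, rfl⟩ := exists_eq_ofCoeff b
  rw [y_mul_ofCoeff, x_mul_ofCoeff, ofCoeff_eq_zero_iff] at h
  exact ⟨_, _, ofCoeff_eq_of_zero (by simpa using congrFun h 3)⟩

theorem exists_of_y_mul_x_mul {b : AlgB k} (h : y * (x * b) = 0) :
    ∃ a a', b = x * a + y * a' := by
  obtain ⟨c, rfl⟩ := exists_eq_ofCoeff b
  rw [x_mul_ofCoeff, y_mul_ofCoeff, ofCoeff_eq_zero_iff] at h
  exact ⟨_, _, ofCoeff_eq_of_zero (by simpa using congrFun h 4)⟩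

/-- Left multiplication by x kills the span of x, xy and yx, which exceeds xB by the socle element
yx. The second summand accounts for it. -/
theorem exists_of_x_mul {b : AlgB k} (h : x * b = 0) : ∃ a a', b = x * a + y * x * a' := by
  obtain ⟨c, rfl⟩ := exists_eq_ofCoeff b
  rw [x_mul_ofCoeff, ofCoeff_eq_zero_iff] at h
  have h₁ : c 0 = 0 := by simpa using congrFun h 1
  have h₃ : c 2 = 0 := by simpa using congrFun h 3
  exact ⟨c 1 • 1 + c 3 • y, c 4 • 1, by simp [ofCoeff, h₁, h₃, mul_add]⟩

theorem exists_of_y_mul {b : AlgB k} (h : y * b = 0) : ∃ a a', b = y * a + x * y * a' := by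
  obtain ⟨c, rfl⟩ := exists_eq_ofCoeff b
  rw [y_mul_ofCoeff, ofCoeff_eq_zero_iff] at h
  have h₁ : c 0 = 0 := by simpa using congrFun h 2
  have h₃ : c 1 = 0 := by simpa using congrFun h 4
  exact ⟨c 2 • 1 + c 4 • x, c 3 • 1, by simp [ofCoeff, h₁, h₃, mul_add]; abel⟩

end

/-! ### The same facts in finitely generated free `B`-modules, by coordinates. -/

section

variable {k : Type u} [Field k] {M : Type u} [AddCommGroup M] [Module (AlgB k) M]
  [Module.Free (AlgB k) M]

theorem x_smul_eq_zero_of_eq_y_smul {m n : M} (h : (x : AlgB k) • m = (y : AlgB k) • n) :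
    (x : AlgB k) • m = 0 := by
  let b := Module.Free.chooseBasis (AlgB k) M
  apply b.repr.injective
  ext i
  have h := DFunLike.congr_fun (congrArg b.repr h) i
  simp only [map_smul, Finsupp.smul_apply, smul_eq_mul] at h
  simpa using x_mul_eq_zero_of_eq_y_mul h

/-- Elements of a finitely generated free module that are killed by `z` are combinations with
coefficients `s` and `t` if this holds in the ring. -/
theorem exists_of_smul_eq_zero {R : Type*} [Ring R] {M : Type*} [AddCommGroup M] [Module R M]
    [Module.Free R M] [Module.Finite R M] {z s t : R}
    (hz : ∀ b : R, z * b = 0 → ∃ a a', b = s * a + t * a') {m : M} (h : z • m = 0) :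
    ∃ n n' : M, m = s • n + t • n' := by
  let b := Module.Free.chooseBasis R M
  have h' : ∀ i, ∃ a a', b.equivFun m i = s * a + t * a' := fun i =>
    hz _ (by rw [← smul_eq_mul, ← Pi.smul_apply, ← map_smul, h, map_zero, Pi.zero_apply])
  choose a a' ha using h'
  refine ⟨b.equivFun.symm a, b.equivFun.symm a', ?_⟩
  rw [← map_smul, ← map_smul, ← map_add, LinearEquiv.eq_symm_apply]
  exact funext ha

variable [Module.Finite (AlgB k) M]

theorem exists_of_x_smul_y_smul {m : M} (h : (x : AlgB k) • (y : AlgB k) • m = 0) :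
    ∃ n n' : M, m = (x : AlgB k) • n + (y : AlgB k) • n' :=
  exists_of_smul_eq_zero (z := x * y) (fun b hb => exists_of_x_mul_y_mul (by rwa [← mul_assoc]))
    (by rwa [mul_smul])

theorem exists_of_y_smul_x_smul {m : M} (h : (y : AlgB k) • (x : AlgB k) • m = 0) :
    ∃ n n' : M, m = (x : AlgB k) • n + (y : AlgB k) • n' :=
  exists_of_smul_eq_zero (z := y * x) (fun b hb => exists_of_y_mul_x_mul (by rwa [← mul_assoc]))
    (by rwa [mul_smul])

theorem exists_of_x_smul {m : M} (h : (x : AlgB k) • m = 0) :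
    ∃ n n' : M, m = (x : AlgB k) • n + (y : AlgB k) • (x : AlgB k) • n' := by
  simpa only [mul_smul] using exists_of_smul_eq_zero (fun b hb => exists_of_x_mul hb) h

theorem exists_of_y_smul {m : M} (h : (y : AlgB k) • m = 0) :
    ∃ n n' : M, m = (y : AlgB k) • n + (x : AlgB k) • (y : AlgB k) • n' := by
  simpa only [mul_smul] using exists_of_smul_eq_zero (fun b hb => exists_of_y_mul hb) h

end

end AlgB

/-! ### Exactness of factorizations modulo `w`, in terms of elements. -/

namespace AlgB

section

variable {k : Type u} [Field k]

section

variable {M : Type u} [AddCommGroup M] [Module (AlgB k) M]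

theorem x_smul_x_smul (m : M) : (x : AlgB k) • (x : AlgB k) • m = 0 := by
  rw [smul_smul, x_mul_x, zero_smul]

theorem y_smul_y_smul (m : M) : (y : AlgB k) • (y : AlgB k) • m = 0 := by
  rw [smul_smul, y_mul_y, zero_smul]

theorem x_smul_y_smul_x_smul (m : M) : (x : AlgB k) • (y : AlgB k) • (x : AlgB k) • m = 0 := by
  rw [smul_smul, smul_smul, x_mul_y_mul_x, zero_smul]

theorem y_smul_x_smul_y_smul (m : M) : (y : AlgB k) • (x : AlgB k) • (y : AlgB k) • m = 0 := by
  rw [smul_smul, smul_smul, y_mul_x_mul_y, zero_smul]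

variable [Module k M] [IsScalarTower k (AlgB k) M]

theorem w_smul (q : k) (m : M) :
    w q • m = (x : AlgB k) • (y : AlgB k) • m - q • (y : AlgB k) • (x : AlgB k) • m := by
  rw [w, sub_smul, mul_smul, smul_assoc, mul_smul]

theorem smul_smul_comm (c : k) (b : AlgB k) (m : M) : b • c • m = c • b • m := by
  rw [← algebraMap_smul (AlgB k) c m, smul_smul, ← Algebra.commutes, mul_smul, algebraMap_smul]

end

variable {F G : Type u} [AddCommGroup F] [Module (AlgB k) F] [Module k F]
  [IsScalarTower k (AlgB k) F] [AddCommGroup G] [Module (AlgB k) G] [Module k G]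
  [IsScalarTower k (AlgB k) G] [Module.Free (AlgB k) F] [Module.Finite (AlgB k) F]
  [Module.Free (AlgB k) G] [Module.Finite (AlgB k) G]

local notation "X" => (x : AlgB k)
local notation "Y" => (y : AlgB k)

/-- Exactness modulo `w` of a factorization `F ⟶ G ⟶ F` of multiplication by `w`, where the second
map is semilinear with respect to the automorphism `ν`. -/
theorem exists_eq_add_w_smul {q : k} (hq : q ≠ 0) (f : F →ₗ[AlgB k] G) (g : G →+ F)
    (hgx : ∀ n, g (X • n) = -q⁻¹ • X • g n) (hgy : ∀ n, g (Y • n) = -q • Y • g n)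
    (hgf : ∀ m, g (f m) = w q • m) (hfg : ∀ n, f (g n) = w q • n) {n : G} {h : F}
    (hn : g n = w q • h) : ∃ (m : F) (e : G), n = f m + w q • e := by
  have hfk : ∀ (c : k) (m : F), f (c • m) = c • f m := fun c m => by
    rw [← algebraMap_smul (AlgB k) c m, map_smul, algebraMap_smul]
  have hgw : ∀ n, g (w q • n) = w q • g n := fun n => by rw [← hfg, hgf]
  have hqi : ∀ {M : Type u} [AddCommGroup M] [Module k M] (m : M), q⁻¹ • q • m = m :=
    fun m => inv_smul_smul₀ hq m
  -- elements of the form `yx e`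
  have key : ∀ (e : G) (h : F), g (Y • X • e) = w q • h → ∃ m, Y • X • e = f m := by
    intro e h he
    have h₁ : g (Y • X • e) = Y • X • g e := by
      rw [hgy, hgx, smul_smul_comm, smul_smul, neg_mul_neg, mul_inv_cancel₀ hq, one_smul]
    -- Moving the yx-part of `w` to the other side turns yx g(e) = w h into an equation between an
    -- x-multiple and a y-multiple, so both sides vanish and `h` lies in the radical.
    have h₂ : X • Y • h = Y • (X • g e + q • X • h) := by
      rw [smul_add, smul_smul_comm, ← h₁, he, w_smul, sub_add_cancel]
    obtain ⟨a, a', rfl⟩ := exists_of_x_smul_y_smul (x_smul_eq_zero_of_eq_y_smul h₂)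
    -- `w` annihilates the radical, so `w • h` is zero.
    have h₃ : Y • X • g e = 0 := by
      rw [← h₁, he, w_smul]
      simp only [smul_add, x_smul_x_smul, y_smul_y_smul, x_smul_y_smul_x_smul,
        y_smul_x_smul_y_smul, smul_zero, add_zero, sub_zero]
    obtain ⟨c, d, hcd⟩ := exists_of_y_smul_x_smul h₃
    -- This is w e = f (g e) with g e = x c + y d, again sorted into x- and y-multiples. The
    -- vanishing y-side expresses yx e through f (y d).
    have h₄ : X • (Y • e - f c) = Y • (f d + q • X • e) := by
      have := hfg e
      rw [hcd, map_add, map_smul, map_smul, w_smul] at this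
      rw [smul_sub, smul_add, smul_smul_comm, sub_eq_iff_eq_add, add_right_comm,
        ← sub_eq_iff_eq_add, ← this, add_comm]
    have h₅ := x_smul_eq_zero_of_eq_y_smul h₄
    rw [h₄, smul_add, smul_smul_comm, add_comm, ← eq_neg_iff_add_eq_zero] at h₅
    refine ⟨-(q⁻¹ • Y • d), ?_⟩
    rw [map_neg, hfk, map_smul, ← smul_neg, ← h₅, hqi]
  -- Since w h = g (f h), subtracting f h reduces to g n = 0. Then w n = f (g n) = 0, which forces
  -- `n` into the radical: n = x a + y b.
  obtain ⟨n, rfl⟩ : ∃ n', n = n' + f h := ⟨n - f h, by abel⟩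
  rw [map_add, hgf, add_eq_right] at hn
  have hwn : w q • n = 0 := by rw [← hfg, hn, map_zero]
  have h₁ : X • Y • n = Y • q • X • n := by
    rw [smul_smul_comm, ← sub_eq_zero, ← w_smul, hwn]
  obtain ⟨a, b, rfl⟩ := exists_of_x_smul_y_smul (x_smul_eq_zero_of_eq_y_smul h₁)
  -- g n = 0 splits into x g(a) = 0 and y g(b) = 0.
  have h₂ : X • (q⁻¹ • g a) = Y • (-q • g b) := by
    rw [map_add, hgx, hgy, neg_smul, neg_add_eq_zero] at hn
    rw [smul_smul_comm, smul_smul_comm, hn]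
  have ha : X • g a = 0 := by
    have := x_smul_eq_zero_of_eq_y_smul h₂
    rwa [smul_smul_comm, smul_eq_zero_iff_right (inv_ne_zero hq)] at this
  have hb : Y • g b = 0 := by
    rwa [smul_smul_comm, smul_smul_comm, ha, smul_zero, eq_comm,
      smul_eq_zero_iff_right (neg_ne_zero.2 hq)] at h₂
  obtain ⟨c, c', hc⟩ := exists_of_x_smul ha
  obtain ⟨d, d', hd⟩ := exists_of_y_smul hb
  have ha' := hfg a
  have hb' := hfg b
  rw [hc, map_add, map_smul, map_smul, map_smul, w_smul] at ha'
  rw [hd, map_add, map_smul, map_smul, map_smul, w_smul] at hb'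
  -- The identities w a = f (g a) and, in `h₄`, w b = f (g b) are expanded and sorted. Each side
  -- vanishes, so f c' + q a and b - f d' lie in the radical, which determines x a and y b up to
  -- `f`-images and terms of degree two.
  have h₃ : X • (Y • a - f c) = Y • (X • (f c' + q • a)) := by
    simp only [smul_sub, smul_add, smul_smul_comm]
    rw [sub_eq_iff_eq_add, add_right_comm, ← sub_eq_iff_eq_add, ← ha', add_comm]
  have h₄ : X • (Y • (b - f d')) = Y • (f d + q • X • b) := by
    simp only [smul_sub, smul_add, smul_smul_comm]
    rw [sub_eq_iff_eq_add, add_right_comm, ← sub_eq_iff_eq_add, ← hb']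
  obtain ⟨a₁, a₂, ha₁⟩ := exists_of_y_smul_x_smul (h₃ ▸ x_smul_eq_zero_of_eq_y_smul h₃)
  obtain ⟨b₁, b₂, hb₁⟩ := exists_of_x_smul_y_smul (x_smul_eq_zero_of_eq_y_smul h₄)
  have hxa : X • a = q⁻¹ • X • Y • a₂ - q⁻¹ • f (X • c') := by
    have := congrArg (fun m => q⁻¹ • X • m) ha₁
    simp only [smul_add, x_smul_x_smul, smul_smul_comm, hqi, zero_add] at this
    rw [map_smul, ← this, add_sub_cancel_left]
  have hyb : Y • b = f (Y • d') + Y • X • b₁ := by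
    have := congrArg (fun m => Y • m) hb₁
    simp only [smul_add, smul_sub, y_smul_y_smul, add_zero] at this
    rw [map_smul, ← this, add_sub_cancel]
  -- Modulo w, xy may be traded for q yx, so only a yx-multiple remains to be treated.
  have hxy : X • Y • a₂ = w q • a₂ + q • Y • X • a₂ := by rw [w_smul, sub_add_cancel]
  have e₁ : X • a + Y • b =
      f (Y • d' - q⁻¹ • X • c') + w q • q⁻¹ • a₂ + Y • X • (a₂ + b₁) := by
    rw [hxa, hyb, hxy, map_sub, hfk, smul_add, hqi, smul_smul_comm]
    simp only [smul_add]
    abel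
  -- Because g n = 0, applying `g` shows that it maps the remaining yx-multiple to a `w`-multiple,
  -- which is the hypothesis of `key`.
  have e₂ := congrArg g e₁
  rw [hn, map_add, map_add, hgf, hgw, ← smul_add, eq_comm, add_comm, ← eq_neg_iff_add_eq_zero,
    ← smul_neg] at e₂
  obtain ⟨m, hm⟩ := key _ _ e₂
  refine ⟨Y • d' - q⁻¹ • X • c' + m + h, q⁻¹ • a₂, ?_⟩
  rw [e₁, hm, map_add, map_add]
  abel

end

end AlgB

/-! ### Reduction of free modules modulo `w`. -/

namespace TwistDatum

section

variable {B : Type u} [Ring B] (D : TwistDatum B)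

/-- Centrality gives (c w) n = w (c n), so sums of products of ideal elements with vectors are again
single multiples of `w`. -/
theorem mem_wSub {M : Type u} [AddCommGroup M] [Module B M] {m : M} :
    m ∈ D.wSub M ↔ ∃ n, m = D.w • n := by
  constructor
  · intro h
    induction h using Submodule.smul_induction_on' with
    | smul r hr n hn =>
      obtain ⟨c, rfl⟩ := Ideal.mem_span_singleton'.1 hr
      exact ⟨c • n, by rw [smul_smul, D.central]⟩
    | add m hm n hn h h' =>
      obtain ⟨a, rfl⟩ := h
      obtain ⟨b, rfl⟩ := h'
      exact ⟨a + b, (smul_add _ _ _).symm⟩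
  · rintro ⟨n, rfl⟩
    exact Submodule.smul_mem_smul (Ideal.mem_span_singleton_self _) trivial

/-- The reduction modulo `w` of a free module is projective. -/
theorem projective_red (M : FreeModCat B) : Module.Projective D.quot (D.red.obj M) := by
  have := M.property.1
  have := M.property.2
  let b := Module.Free.chooseBasis B M.obj
  -- Coordinates modulo `w` will give `s`, and the residues of the basis vectors give `p`. The
  -- identity p ∘ s = id makes the reduction a summand of a free module, and freeness itself is not
  -- needed.
  let t : M.obj →ₗ[B] (Module.Free.ChooseBasisIndex B M.obj → D.quot) :=
    LinearMap.pi fun i => (Submodule.mkQ (Ideal.span {D.w})).comp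
      ((LinearMap.proj i).comp b.equivFun.toLinearMap)
  have ht : D.wSub M.obj ≤ LinearMap.ker t := by
    intro m hm
    obtain ⟨n, rfl⟩ := D.mem_wSub.1 hm
    rw [LinearMap.mem_ker]
    ext i
    change Ideal.Quotient.mk _ (b.equivFun (D.w • n) i) = 0
    rw [map_smul, Pi.smul_apply, smul_eq_mul, ← D.central, Ideal.Quotient.eq_zero_iff_mem]
    exact Ideal.mul_mem_left _ _ (Ideal.mem_span_singleton_self _)
  let s : (M.obj ⧸ D.wSub M.obj) →ₗ[D.quot] (Module.Free.ChooseBasisIndex B M.obj → D.quot) :=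
    { toFun := (D.wSub M.obj).liftQ t ht
      map_add' := map_add _
      map_smul' := by
        intro a m
        obtain ⟨r, rfl⟩ := Ideal.Quotient.mk_surjective a
        obtain ⟨m, rfl⟩ := Submodule.Quotient.mk_surjective _ m
        exact map_smul t r m }
  let p : (Module.Free.ChooseBasisIndex B M.obj → D.quot) →ₗ[D.quot] (M.obj ⧸ D.wSub M.obj) :=
    Fintype.linearCombination D.quot fun i => Submodule.Quotient.mk (b i)
  refine Module.Projective.of_split (M := Module.Free.ChooseBasisIndex B M.obj → D.quot) s p ?_
  apply LinearMap.ext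
  intro m
  obtain ⟨m, rfl⟩ := Submodule.Quotient.mk_surjective _ m
  conv_rhs => rw [← b.sum_equivFun m]
  exact (map_sum (D.wSub M.obj).mkQ _ _).symm

end

end TwistDatum

/-! ### Exactness modulo `w` in the category of factorizations. -/

namespace AlgB

/-- A factorization is exact modulo `w`. -/
theorem mem_range_red_of_red_eq_zero {k : Type u} [Field k] {q : k} {hq : q ≠ 0}
    (Z : Factorization (datum q hq).eta) (n : (datum q hq).red.obj Z.N)
    (hn : (datum q hq).red.map Z.g n = 0) :
    n ∈ LinearMap.range ((datum q hq).red.map Z.f).hom.hom := by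
  have := Z.M.property.1
  have := Z.M.property.2
  have := Z.N.property.1
  have := Z.N.property.2
  obtain ⟨n, rfl⟩ := Submodule.Quotient.mk_surjective _ n
  let _ : Module k Z.M.obj := Module.compHom Z.M.obj (algebraMap k (AlgB k))
  let _ : Module k Z.N.obj := Module.compHom Z.N.obj (algebraMap k (AlgB k))
  have : IsScalarTower k (AlgB k) Z.M.obj :=
    ⟨fun c a m => by rw [Algebra.smul_def, mul_smul]; rfl⟩
  have : IsScalarTower k (AlgB k) Z.N.obj :=
    ⟨fun c a m => by rw [Algebra.smul_def, mul_smul]; rfl⟩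
  let g₀ : Z.N.obj →ₗ[AlgB k] (datum q hq).Twisted Z.M.obj := Z.g.hom.hom
  have hn' : g₀ n ∈ (datum q hq).wSub ((datum q hq).Twisted Z.M.obj) :=
    (Submodule.Quotient.mk_eq_zero _).1 hn
  obtain ⟨h, hh⟩ := (datum q hq).mem_wSub.1 hn'
  obtain ⟨h, rfl⟩ := ((datum q hq).toTwisted Z.M.obj).surjective h
  -- `w` acts on the twisted module as ν w = w, so membership in the `w`-multiples is unaffected by
  -- untwisting. The untwisted map `g` below is semilinear along ν, as `exists_eq_add_w_smul`
  -- requires.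
  have hw : (datum q hq).ν (datum q hq).w = w q := nu_w q hq
  rw [TwistDatum.smul_toTwisted, hw] at hh
  let g : Z.N.obj →+ Z.M.obj :=
    ((datum q hq).toTwisted Z.M.obj).symm.toAddMonoidHom.comp g₀.toAddMonoidHom
  have hg : ∀ (b : AlgB k) (n : Z.N.obj), g (b • n) = nu q hq b • g n := fun b n =>
    g₀.map_smul b n
  obtain ⟨m, e, rfl⟩ := exists_eq_add_w_smul hq Z.f.hom.hom g
    (fun n => by rw [hg, nu_x, smul_assoc]) (fun n => by rw [hg, nu_y, smul_assoc])
    (fun m => ConcreteCategory.congr_hom Z.fg m) (fun n => ConcreteCategory.congr_hom Z.gf n)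
    (n := n) (h := h) hh
  refine ⟨Submodule.Quotient.mk m, ?_⟩
  change Submodule.Quotient.mk (Z.f.hom.hom m) = Submodule.Quotient.mk _
  rw [Submodule.Quotient.eq]
  refine (datum q hq).mem_wSub.2 ⟨-e, ?_⟩
  rw [smul_neg]
  change _ - (_ + w q • e) = - (w q • e)
  abel

end AlgB

/-! ### Recognizing pushouts of finitely generated modules. -/

namespace FGModuleCat

section

variable {A : Type u} [Ring A]

theorem exists_desc {V C W : FGModuleCat.{u} A} (s : V ⟶ C) (hs : Function.Surjective s) (h : V ⟶ W)
    (hk : ∀ v, s v = 0 → h v = 0) : ∃ d : C ⟶ W, s ≫ d = h := by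
  refine ⟨ObjectProperty.homMk (ModuleCat.ofHom (((LinearMap.ker s.hom.hom).liftQ h.hom.hom hk).comp
    (s.hom.hom.quotKerEquivOfSurjective hs).symm.toLinearMap)), ?_⟩
  ext v
  change (LinearMap.ker s.hom.hom).liftQ h.hom.hom hk
    ((s.hom.hom.quotKerEquivOfSurjective hs).symm (s.hom.hom v)) = _
  rw [← s.hom.hom.quotKerEquivOfSurjective_apply_mk hs, LinearEquiv.symm_apply_apply]
  rfl

/-- A square with vertex `C` is a pushout if `C` is the quotient of `P × N` by the image of `M`. -/
theorem isPushout_of_exact {M P N C : FGModuleCat.{u} A} {j : M ⟶ P} {f : M ⟶ N} {a : P ⟶ C}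
    {b : N ⟶ C} (comm : j ≫ a = f ≫ b) (surj : ∀ c, ∃ p n, a p + b n = c)
    (ker : ∀ p n, a p + b n = 0 → ∃ m, p = j m ∧ n = -f m) : IsPushout j f a b := by
  let s : FGModuleCat.of A (P × N) ⟶ C := FGModuleCat.ofHom (a.hom.hom.coprod b.hom.hom)
  have hs : Function.Surjective s := fun c => by
    obtain ⟨p, n, h⟩ := surj c
    exact ⟨(p, n), h⟩
  have hdesc : ∀ t : PushoutCocone j f, ∃ d : C ⟶ t.pt, s ≫ d =
      FGModuleCat.ofHom (t.inl.hom.hom.coprod t.inr.hom.hom) := fun t =>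
    exists_desc s hs _ (by
      rintro ⟨p, n⟩ h
      obtain ⟨m, rfl, rfl⟩ := ker p n h
      have := ConcreteCategory.congr_hom t.condition m
      change t.inl (j m) + t.inr (-f m) = 0
      rw [map_neg, ← sub_eq_add_neg, sub_eq_zero]
      exact this)
  choose d hd using hdesc
  refine ⟨⟨comm⟩, ⟨PushoutCocone.IsColimit.mk _ d (fun t => ?_) (fun t => ?_) ?_⟩⟩
  · ext p
    have := ConcreteCategory.congr_hom (hd t) (p, 0)
    change d t (a p + b 0) = t.inl p + t.inr 0 at this
    rw [map_zero, map_zero, add_zero, add_zero] at this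
    exact this
  · ext n
    have := ConcreteCategory.congr_hom (hd t) (0, n)
    change d t (a 0 + b n) = t.inl 0 + t.inr n at this
    rw [map_zero, map_zero, zero_add, zero_add] at this
    exact this
  · intro t m h₁ h₂
    ext c
    obtain ⟨⟨p, n⟩, rfl⟩ := hs c
    have h := ConcreteCategory.congr_hom (hd t) (p, n)
    have h₁ := ConcreteCategory.congr_hom h₁ p
    have h₂ := ConcreteCategory.congr_hom h₂ n
    change m (a p) = t.inl p at h₁
    change m (b n) = t.inr n at h₂
    change m (a p + b n) = d t (s (p, n))
    refine Eq.trans ?_ h.symm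
    rw [map_add, h₁, h₂]
    rfl

/-- A cokernel is a pushout along the map to the zero module. In this form suspensions and cones
fall under the same comparison lemma. -/
theorem isPushout_zero_of_exact {M P Q : FGModuleCat.{u} A} {j : M ⟶ P} {a : P ⟶ Q}
    (comm : j ≫ a = 0) (surj : Function.Surjective a) (ker : ∀ p, a p = 0 → ∃ m, p = j m) :
    IsPushout j (0 : M ⟶ FGModuleCat.of A PUnit.{u + 1}) a 0 := by
  refine isPushout_of_exact (by rw [comm, zero_comp]) (fun c => ?_) (fun p n h => ?_)
  · obtain ⟨p, rfl⟩ := surj c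
    exact ⟨p, 0, by rw [map_zero, add_zero]⟩
  · obtain ⟨m, rfl⟩ := ker p (by
      rw [← h]
      exact (add_zero _).symm)
    exact ⟨m, rfl, rfl⟩

end

end FGModuleCat

/-! ### Independence, up to stable isomorphism, of the projective module used for cones and
suspensions. -/

namespace StableModCat

section

variable {A : Type u} [Ring A]

theorem proj_map_eq {M N : FGModuleCat.{u} A} {f g : M ⟶ N} (P : FGModuleCat.{u} A)
    (hP : Module.Projective A P) (a : M ⟶ P) (b : P ⟶ N) (h : f - g = a ≫ b) :
    (proj A).map f = (proj A).map g :=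
  CategoryTheory.Quotient.sound _ ⟨P, hP, a, b, h⟩

/-- The pushouts of a map along two embeddings into projective modules that extend along each other
are stably isomorphic. -/
theorem exists_isIso_of_isPushout {M P P' N C C' : FGModuleCat.{u} A} {j : M ⟶ P} {j' : M ⟶ P'}
    {f : M ⟶ N} {a : P ⟶ C} {b : N ⟶ C} {a' : P' ⟶ C'} {b' : N ⟶ C'} (sq : IsPushout j f a b)
    (sq' : IsPushout j' f a' b') (hP : Module.Projective A P) (hP' : Module.Projective A P')
    {e : P ⟶ P'} {d : P' ⟶ P} (he : j ≫ e = j') (hd : j' ≫ d = j) :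
    ∃ κ : C ⟶ C', a ≫ κ = e ≫ a' ∧ b ≫ κ = b' ∧ IsIso ((proj A).map κ) := by
  have hκ : j ≫ e ≫ a' = f ≫ b' := by rw [← Category.assoc, he, sq'.w]
  have hl : j' ≫ d ≫ a = f ≫ b := by rw [← Category.assoc, hd, sq.w]
  -- e ≫ d - 𝟙 vanishes on `M`, so with 0 on `N` it descends to a map C ⟶ P. Followed by `a`, this
  -- is the defect of the round trip C ⟶ C' ⟶ C from the identity, which therefore factors through
  -- the projective `P`.
  have h : j ≫ (e ≫ d - 𝟙 P) = f ≫ 0 := by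
    rw [Preadditive.comp_sub, ← Category.assoc, he, hd, Category.comp_id, sub_self, comp_zero]
  have h' : j' ≫ (d ≫ e - 𝟙 P') = f ≫ 0 := by
    rw [Preadditive.comp_sub, ← Category.assoc, hd, he, Category.comp_id, sub_self, comp_zero]
  refine ⟨sq.desc _ _ hκ, sq.inl_desc _ _ _, sq.inr_desc _ _ _,
    ⟨(proj A).map (sq'.desc _ _ hl), ?_, ?_⟩⟩
  · rw [← Functor.map_comp, ← CategoryTheory.Functor.map_id]
    refine proj_map_eq P hP (sq.desc _ _ h) a (sq.hom_ext ?_ ?_) <;> simp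
  · rw [← Functor.map_comp, ← CategoryTheory.Functor.map_id]
    refine proj_map_eq P' hP' (sq'.desc _ _ h') a' (sq'.hom_ext ?_ ?_) <;> simp

end

section

variable (k : Type u) [Field k] {A : Type u} [Ring A] [Algebra k A]

/-- The embedding `M ⟶ I M` extends along injective maps. -/
theorem exists_toInj_extension {M P : ModuleCat.{u} A} (j : M ⟶ P) (hj : Function.Injective j) :
    ∃ e : P ⟶ (inj k A).obj M, j ≫ e = (toInj k A).app M := by
  have split : ∀ {V W : ModuleCat.{u} k} (i : V ⟶ W), Function.Injective i → ∃ r, i ≫ r = 𝟙 V := by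
    intro V W i hi
    obtain ⟨r, hr⟩ := i.hom.exists_leftInverse_of_injective (LinearMap.ker_eq_bot.2 hi)
    exact ⟨ModuleCat.ofHom r, ModuleCat.hom_ext hr⟩
  -- Over the field `k` the injection splits. The adjunct of a `k`-linear retraction under
  -- restriction and coextension of scalars is the wanted `A`-linear extension.
  obtain ⟨r, hr⟩ := split ((ModuleCat.restrictScalars (algebraMap k A)).map j) hj
  refine ⟨(ModuleCat.restrictCoextendScalarsAdj.{u, u, u} (algebraMap k A)).homEquiv _ _ r, ?_⟩
  exact (Adjunction.homEquiv_naturality_left _ _ _).symm.trans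
    ((congrArg _ hr).trans (Adjunction.homEquiv_id _ _))

end

/-- Maps into finitely generated projective modules extend along injective maps. -/
theorem exists_extension_of_projective (k : Type u) [Field k] {A : Type u} [Ring A]
    [Algebra k A] [Module.Finite k A] [HasFrobeniusForm k A] {M N P : FGModuleCat.{u} A} (j : M ⟶ N)
    (hj : Function.Injective j) (hP : Module.Projective A P) (h : M ⟶ P) :
    ∃ e : N ⟶ P, j ≫ e = h := by
  have : Module.Finite A P.obj := P.property
  have : Module.Projective A P.obj := hP
  obtain ⟨e, he⟩ := exists_toInj_extension k j.hom hj
  obtain ⟨r, hr⟩ := exists_retraction k P.obj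
  -- Over a Frobenius algebra `P` is a retract of I P, so it suffices to extend into I M, apply I h
  -- and retract.
  refine ⟨ObjectProperty.homMk (e ≫ (inj k A).map h.hom ≫ ModuleCat.ofHom r), ?_⟩
  ext m
  have h₁ := ConcreteCategory.congr_hom he m
  have h₂ := ConcreteCategory.congr_hom ((toInj k A).naturality h.hom) m
  change e (j m) = (toInj k A).app M.obj m at h₁
  change (toInj k A).app P.obj (h m) = (inj k A).map h.hom ((toInj k A).app M.obj m) at h₂
  change r ((inj k A).map h.hom (e (j m))) = h m
  rw [h₁, ← h₂, hr]

section

variable (k : Type u) [Field k] {A : Type u} [Ring A] [Algebra k A] [Module.Finite k A]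
  [HasFrobeniusForm k A]

/-- The finitely generated module `I M`. -/
noncomputable abbrev injObj (M : FGModuleCat.{u} A) : FGModuleCat.{u} A :=
  FGModuleCat.of A ((inj k A).obj M.obj)

/-- The embedding of `M` into `I M`. -/
noncomputable abbrev toInjObj (M : FGModuleCat.{u} A) : M ⟶ injObj k M :=
  FGModuleCat.ofHom ((toInj k A).app M.obj).hom

/-- The map `I M ⟶ I N` induced by a map `M ⟶ N`. -/
noncomputable abbrev injMap {M N : FGModuleCat.{u} A} (f : M ⟶ N) : injObj k M ⟶ injObj k N :=
  FGModuleCat.ofHom ((inj k A).map f.hom).hom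

/-- The projection of `I M` onto `Σ M`. -/
noncomputable abbrev toSusp (M : FGModuleCat.{u} A) : injObj k M ⟶ (suspFunctor k).obj M :=
  FGModuleCat.ofHom (LinearMap.range ((toInj k A).app M.obj).hom).mkQ

/-- The map from `I M` to the pushout `C_f`. -/
noncomputable def coneInl {M N : FGModuleCat.{u} A} (f : M ⟶ N) : injObj k M ⟶ cone k f :=
  FGModuleCat.ofHom ((coneRel k f).mkQ.comp (LinearMap.inl A _ _))

theorem toInjObj_naturality {M N : FGModuleCat.{u} A} (f : M ⟶ N) :
    toInjObj k M ≫ injMap k f = f ≫ toInjObj k N := by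
  ext m
  exact (ConcreteCategory.congr_hom ((toInj k A).naturality f.hom) m).symm

theorem toSusp_naturality {M N : FGModuleCat.{u} A} (f : M ⟶ N) :
    toSusp k M ≫ (suspFunctor k).map f = injMap k f ≫ toSusp k N := rfl

theorem coneInl_fst {M N : FGModuleCat.{u} A} (f : M ⟶ N) :
    coneInl k f ≫ coneFst k f = toSusp k M := rfl

theorem coneInr_fst {M N : FGModuleCat.{u} A} (f : M ⟶ N) :
    coneInr k f ≫ coneFst k f = 0 := rfl

theorem isPushout_cone {M N : FGModuleCat.{u} A} (f : M ⟶ N) :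
    IsPushout (toInjObj k M) f (coneInl k f) (coneInr k f) := by
  have hadd : ∀ p n, coneInl k f p + coneInr k f n = (coneRel k f).mkQ (p, n) := fun p n => by
    refine ((coneRel k f).mkQ.map_add (p, 0) (0, n)).symm.trans ?_
    rw [Prod.mk_add_mk, add_zero, zero_add]
  refine FGModuleCat.isPushout_of_exact ?_ (fun c => ?_) (fun p n h => ?_)
  · ext m
    refine (Submodule.Quotient.eq (coneRel k f)).2 ⟨m, ?_⟩
    refine Prod.ext ?_ ?_
    · exact (sub_zero _).symm
    · exact (zero_sub _).symm
  · obtain ⟨⟨p, n⟩, rfl⟩ := (coneRel k f).mkQ_surjective c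
    exact ⟨p, n, hadd p n⟩
  · rw [hadd] at h
    obtain ⟨m, hm⟩ := (Submodule.Quotient.mk_eq_zero _).1 h
    exact ⟨m, (congrArg Prod.fst hm).symm, (congrArg Prod.snd hm).symm⟩

theorem isPushout_toSusp (M : FGModuleCat.{u} A) :
    IsPushout (toInjObj k M) (0 : M ⟶ FGModuleCat.of A PUnit.{u + 1}) (toSusp k M) 0 := by
  refine FGModuleCat.isPushout_zero_of_exact ?_ (Submodule.mkQ_surjective _) (fun p h => ?_)
  · ext m
    exact (Submodule.Quotient.mk_eq_zero _).2 ⟨m, rfl⟩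
  · obtain ⟨m, hm⟩ := (Submodule.Quotient.mk_eq_zero _).1 h
    exact ⟨m, hm.symm⟩

theorem projective_injObj (M : FGModuleCat.{u} A) : Module.Projective A (injObj k M) := by
  have : Module.Finite A M.obj := M.property
  exact projective_inj k M.obj

/-- The pushout of `f` along an embedding `j` of `M` into a projective module is stably isomorphic
to the cone of `f`. -/
theorem exists_isIso_to_cone {M N P C : FGModuleCat.{u} A} {j : M ⟶ P} {f : M ⟶ N} {a : P ⟶ C}
    {b : N ⟶ C} (sq : IsPushout j f a b) (hP : Module.Projective A P)
    {e : P ⟶ injObj k M} (he : j ≫ e = toInjObj k M) :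
    ∃ κ : C ⟶ cone k f, a ≫ κ = e ≫ coneInl k f ∧ b ≫ κ = coneInr k f ∧
      IsIso ((proj A).map κ) := by
  -- The backward map `d` may be any extension, supplied by relative injectivity of `P`. The forward
  -- map `e` is an argument so that the comparisons with the cone and with the suspension can share
  -- it.
  obtain ⟨d, hd⟩ := exists_extension_of_projective k (toInjObj k M) (toInj_injective k M.obj) hP j
  exact exists_isIso_of_isPushout sq (isPushout_cone k f) hP (projective_injObj k M) he hd

/-- The cokernel of an embedding `j` of `M` into a projective module is stably isomorphic to the
suspension of `M`. -/
theorem exists_isIso_to_susp {M P Q : FGModuleCat.{u} A} {j : M ⟶ P} {a : P ⟶ Q}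
    (sq : IsPushout j (0 : M ⟶ FGModuleCat.of A PUnit.{u + 1}) a 0)
    (hP : Module.Projective A P) {e : P ⟶ injObj k M}
    (he : j ≫ e = toInjObj k M) :
    ∃ θ : Q ⟶ (suspFunctor k).obj M, a ≫ θ = e ≫ toSusp k M ∧ IsIso ((proj A).map θ) := by
  obtain ⟨d, hd⟩ := exists_extension_of_projective k (toInjObj k M) (toInj_injective k M.obj) hP j
  obtain ⟨θ, h, -, h'⟩ :=
    exists_isIso_of_isPushout sq (isPushout_toSusp k M) hP (projective_injObj k M) he hd
  exact ⟨θ, h, h'⟩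

end

end StableModCat

/-! ### Images of reduced factorizations, of their suspensions and of mapping cones. -/

namespace TwistDatum

section

variable {B : Type u} [Ring B] (D : TwistDatum B)

instance : D.red.Additive where
  map_add {M N f g} := by
    ext m
    obtain ⟨m, rfl⟩ := Submodule.Quotient.mk_surjective _ m
    rfl

/-- As ν w = w, the vector w m is a `w`-multiple for the twisted action as well. -/
theorem red_map_eta (M : FreeModCat B) : D.red.map (D.eta.η.app M) = 0 := by
  ext m
  obtain ⟨m, rfl⟩ := Submodule.Quotient.mk_surjective _ m
  refine (Submodule.Quotient.mk_eq_zero _).2 (D.mem_wSub.2 ⟨D.toTwisted M.obj m, ?_⟩)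
  have h : D.ν D.w = D.w := by simpa using D.fixed 1
  have h' := D.smul_toTwisted D.w (M := M.obj) m
  rw [h] at h'
  exact h'.symm

/-- The inclusion of the image of the reduction of `f` for a factorization `(F, G, f, g)`. -/
noncomputable def imageι (Z : Factorization D.eta) : D.imageFunctor.obj Z ⟶ D.red.obj Z.N :=
  ObjectProperty.homMk (ModuleCat.ofHom (LinearMap.range (D.red.map Z.f).hom.hom).subtype)

/-- The projection onto the image of the reduction of `f` for a factorization `(F, G, f, g)`. -/
noncomputable def imageπ (Z : Factorization D.eta) : D.red.obj Z.M ⟶ D.imageFunctor.obj Z :=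
  ObjectProperty.homMk (ModuleCat.ofHom (D.red.map Z.f).hom.hom.rangeRestrict)

theorem imageπ_ι (Z : Factorization D.eta) : D.imageπ Z ≫ D.imageι Z = D.red.map Z.f := rfl

theorem imageι_injective (Z : Factorization D.eta) : Function.Injective (D.imageι Z) :=
  Subtype.val_injective

theorem imageπ_surjective (Z : Factorization D.eta) : Function.Surjective (D.imageπ Z) :=
  LinearMap.surjective_rangeRestrict _

theorem comp_imageι_injective {V : FGModuleCat.{u} D.quot} {Z : Factorization D.eta}
    {a b : V ⟶ D.imageFunctor.obj Z} (h : a ≫ D.imageι Z = b ≫ D.imageι Z) : a = b := by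
  ext v
  exact D.imageι_injective Z (ConcreteCategory.congr_hom h v)

theorem imageπ_comp_injective {V : FGModuleCat.{u} D.quot} {Z : Factorization D.eta}
    {a b : D.imageFunctor.obj Z ⟶ V} (h : D.imageπ Z ≫ a = D.imageπ Z ≫ b) : a = b := by
  ext v
  obtain ⟨m, rfl⟩ := D.imageπ_surjective Z v
  exact ConcreteCategory.congr_hom h m

theorem imageι_naturality {Y Z : Factorization D.eta} (a : Y ⟶ Z) :
    D.imageFunctor.map a ≫ D.imageι Z = D.imageι Y ≫ D.red.map a.φ := rfl

theorem imageπ_naturality {Y Z : Factorization D.eta} (a : Y ⟶ Z) :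
    D.imageπ Y ≫ D.imageFunctor.map a = D.red.map a.ψ ≫ D.imageπ Z := by
  apply D.comp_imageι_injective
  rw [Category.assoc, Category.assoc, imageι_naturality, imageπ_ι, ← Category.assoc, imageπ_ι,
    ← Functor.map_comp, ← Functor.map_comp, a.comm_f]

instance : D.imageFunctor.Additive where
  map_add {Y Z a b} := by
    apply D.comp_imageι_injective
    rw [Preadditive.add_comp, imageι_naturality, imageι_naturality, imageι_naturality,
      Factorization.add_φ, Functor.map_add, Preadditive.comp_add]

/-- The formal half of exactness: ḡ f̄ is the reduction of η. -/
theorem imageι_red_g (Z : Factorization D.eta) : D.imageι Z ≫ D.red.map Z.g = 0 := by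
  apply D.imageπ_comp_injective
  rw [← Category.assoc, imageπ_ι, ← Functor.map_comp, Z.fg, red_map_eta, comp_zero]

/-- In φ - φ' = t g₁ + f₂ s the first term vanishes on im f̄₁, and the second factors through the
projective module F̄₂. -/
theorem stablyEqual_image_of_homotopic (Y Z : Factorization D.eta) (a b : Y ⟶ Z)
    (h : Factorization.homotopic D.eta a b) :
    (StableModCat.proj D.quot).map (D.imageFunctor.map a) =
      (StableModCat.proj D.quot).map (D.imageFunctor.map b) := by
  obtain ⟨s, t, r, -, -, h⟩ := h
  refine StableModCat.proj_map_eq (D.red.obj Z.M) (D.projective_red Z.M)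
    (D.imageι Y ≫ D.red.map s) (D.imageπ Z) (D.comp_imageι_injective ?_)
  rw [Preadditive.sub_comp, imageι_naturality, imageι_naturality, ← Preadditive.comp_sub,
    ← Functor.map_sub, h, Functor.map_add, Preadditive.comp_add, Functor.map_comp,
    ← Category.assoc, imageι_red_g, zero_comp, zero_add, Functor.map_comp, Category.assoc,
    Category.assoc, imageπ_ι]

/-- The functor from the homotopy category of factorizations to the stable module category that is
induced by reduction modulo `w`. -/
noncomputable def stableImage : HFactorization D.eta ⥤ StableModCat D.quot :=
  CategoryTheory.Quotient.lift _ (D.imageFunctor ⋙ StableModCat.proj D.quot)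
    D.stablyEqual_image_of_homotopic

instance : D.stableImage.Additive where
  map_add {Y Z a b} := by
    obtain ⟨a, rfl⟩ := (HFactorization.proj D.eta).map_surjective (X := Y.as) (Y := Z.as) a
    obtain ⟨b, rfl⟩ := (HFactorization.proj D.eta).map_surjective (X := Y.as) (Y := Z.as) b
    exact congrArg (StableModCat.proj D.quot).map (D.imageFunctor.map_add (f := a) (g := b))

/-- The projection of the reduction of `G` onto the image of the suspension of `(F, G, f, g)`. -/
noncomputable def suspImageπ (Z : Factorization D.eta) :
    D.red.obj Z.N ⟶ D.imageFunctor.obj ((Factorization.suspension D.eta).obj Z) :=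
  D.imageπ ((Factorization.suspension D.eta).obj Z)

/-- The inclusion of the image of the suspension of `(F, G, f, g)` into the reduction of `_ν F`. -/
noncomputable def suspImageι (Z : Factorization D.eta) :
    D.imageFunctor.obj ((Factorization.suspension D.eta).obj Z) ⟶ D.red.obj (D.twist.obj Z.M) :=
  D.imageι ((Factorization.suspension D.eta).obj Z)

theorem suspImageπ_ι (Z : Factorization D.eta) :
    D.suspImageπ Z ≫ D.suspImageι Z = -D.red.map Z.g :=
  (D.imageπ_ι ((Factorization.suspension D.eta).obj Z)).trans D.red.map_neg

theorem suspImageπ_naturality {Y Z : Factorization D.eta} (a : Y ⟶ Z) :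
    D.suspImageπ Y ≫ D.imageFunctor.map ((Factorization.suspension D.eta).map a) =
      D.red.map a.φ ≫ D.suspImageπ Z :=
  D.imageπ_naturality ((Factorization.suspension D.eta).map a)

theorem suspImageπ_comp_injective {V : FGModuleCat.{u} D.quot} {Z : Factorization D.eta}
    {a b : D.imageFunctor.obj ((Factorization.suspension D.eta).obj Z) ⟶ V}
    (h : D.suspImageπ Z ≫ a = D.suspImageπ Z ≫ b) : a = b :=
  D.imageπ_comp_injective h

/-- For a factorization `(F, G, f, g)` that is exact modulo `w`, the image of its suspension is the
quotient of the reduction of `G` by its image. -/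
theorem isPushout_suspImage (Z : Factorization D.eta)
    (hZ : ∀ n, D.red.map Z.g n = 0 → n ∈ LinearMap.range (D.red.map Z.f).hom.hom) :
    IsPushout (D.imageι Z) (0 : _ ⟶ FGModuleCat.of D.quot PUnit.{u + 1}) (D.suspImageπ Z) 0 := by
  have hinj : Function.Injective (D.suspImageι Z) :=
    D.imageι_injective ((Factorization.suspension D.eta).obj Z)
  have hg : ∀ n, D.suspImageι Z (D.suspImageπ Z n) = -D.red.map Z.g n := fun n =>
    ConcreteCategory.congr_hom (D.suspImageπ_ι Z) n
  refine FGModuleCat.isPushout_zero_of_exact ?_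
    (D.imageπ_surjective ((Factorization.suspension D.eta).obj Z)) (fun n hn => ?_)
  · ext m
    apply hinj
    refine (hg _).trans ?_
    have := ConcreteCategory.congr_hom (D.imageι_red_g Z) m
    exact (congrArg Neg.neg this).trans (neg_zero.trans (map_zero (D.suspImageι Z).hom.hom).symm)
  · have h := hg n
    rw [hn, map_zero, eq_comm, neg_eq_zero] at h
    exact ⟨⟨n, hZ n h⟩, rfl⟩

/-- If the components of `W` are direct sums of the components of `Z` and of the suspension of `Y`,
as for the mapping cone of `a : Y ⟶ Z`, then the image of `W` is a pushout. -/
theorem isPushout_image_of_splitting {Y Z W : Factorization D.eta} (a : Y ⟶ Z) (i : Z ⟶ W)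
    (l : Y.N ⟶ W.M) (p : W.M ⟶ Y.N) (s : W.M ⟶ Z.M) (total : p ≫ l + s ≫ i.ψ = 𝟙 W.M)
    (l' : D.twist.obj Y.M ⟶ W.N) (p' : W.N ⟶ D.twist.obj Y.M) (s' : W.N ⟶ Z.N)
    (hlp : l' ≫ p' = 𝟙 _) (hls : l' ≫ s' = 0) (hip : i.φ ≫ p' = 0) (his : i.φ ≫ s' = 𝟙 _)
    (hl : l ≫ W.f = -Y.g ≫ l' + a.φ ≫ i.φ)
    (hY : ∀ n, D.red.map Y.g n = 0 → n ∈ LinearMap.range (D.red.map Y.f).hom.hom) :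
    IsPushout (D.imageι Y) (D.imageFunctor.map a) (D.red.map l ≫ D.imageπ W)
      (D.imageFunctor.map i) := by
  have hl' : (D.red.map l ≫ D.imageπ W) ≫ D.imageι W =
      -D.red.map Y.g ≫ D.red.map l' + D.red.map a.φ ≫ D.red.map i.φ := by
    rw [Category.assoc, imageπ_ι, ← Functor.map_comp, hl, Functor.map_add, Functor.map_neg,
      Functor.map_comp, Functor.map_comp]
  have hr : D.imageFunctor.map i ≫ D.imageι W = D.imageι Z ≫ D.red.map i.φ :=
    imageι_naturality ..
  refine FGModuleCat.isPushout_of_exact (D.comp_imageι_injective ?_) (fun c => ?_)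
    (fun n m h => ?_)
  · rw [Category.assoc, hl', Category.assoc, hr, Preadditive.comp_add, Preadditive.comp_neg,
      ← Category.assoc, imageι_red_g, zero_comp, neg_zero, zero_add, ← Category.assoc,
      ← Category.assoc, imageι_naturality]
  · obtain ⟨v, rfl⟩ := D.imageπ_surjective _ c
    refine ⟨D.red.map p v, D.imageπ Z (D.red.map s v), ?_⟩
    have h₁ : D.red.map p ≫ D.red.map l ≫ D.imageπ W +
        D.red.map s ≫ D.imageπ Z ≫ D.imageFunctor.map i = D.imageπ W := by
      rw [imageπ_naturality, ← Category.assoc, ← Category.assoc, ← Functor.map_comp,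
        ← Functor.map_comp, ← Preadditive.add_comp, ← Functor.map_add, total,
        CategoryTheory.Functor.map_id, Category.id_comp]
    exact ConcreteCategory.congr_hom h₁ v
  -- In the two components of the reduction of `W.N` the pair (n, m) becomes (-ḡ n, φ̄ n + m). The
  -- first component puts `n` in im f̄ by exactness, and the second gives m = -φ̄ n.
  · have h₁ : D.imageι W ((D.red.map l ≫ D.imageπ W) n) +
        D.imageι W (D.imageFunctor.map i m) = 0 := by
      rw [← map_add, h, map_zero]
    have hfst := congrArg (D.red.map p') h₁
    have hsnd := congrArg (D.red.map s') h₁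
    rw [map_add, map_zero] at hfst hsnd
    have e₁ : ((D.red.map l ≫ D.imageπ W) ≫ D.imageι W) ≫ D.red.map p' = -D.red.map Y.g := by
      rw [hl']
      simp [← Functor.map_comp, hlp, hip]
    have e₂ : ((D.red.map l ≫ D.imageπ W) ≫ D.imageι W) ≫ D.red.map s' = D.red.map a.φ := by
      rw [hl']
      simp [← Functor.map_comp, hls, his]
    have e₃ : (D.imageFunctor.map i ≫ D.imageι W) ≫ D.red.map p' = 0 := by
      rw [hr]
      simp [← Functor.map_comp, hip]
    have e₄ : (D.imageFunctor.map i ≫ D.imageι W) ≫ D.red.map s' = D.imageι Z := by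
      rw [hr]
      simp [← Functor.map_comp, his]
    have hn : -D.red.map Y.g n + 0 = 0 :=
      (congrArg₂ (· + ·) (ConcreteCategory.congr_hom e₁ n)
        (ConcreteCategory.congr_hom e₃ m)).symm.trans hfst
    have hm : D.red.map a.φ n + D.imageι Z m = 0 :=
      (congrArg₂ (· + ·) (ConcreteCategory.congr_hom e₂ n)
        (ConcreteCategory.congr_hom e₄ m)).symm.trans hsnd
    rw [add_zero, neg_eq_zero] at hn
    refine ⟨⟨n, hY n hn⟩, rfl, D.imageι_injective Z ?_⟩
    rw [map_neg, eq_neg_iff_add_eq_zero, add_comm]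
    exact hm

/-- The inclusion of the reduction of `G` into the image of a mapping cone. -/
noncomputable def coneImageInl {Y Z : Factorization D.eta} (a : Y ⟶ Z) :
    D.red.obj Y.N ⟶ D.imageFunctor.obj (Factorization.cone a) :=
  D.red.map (biprod.inl : Y.N ⟶ Y.N ⊞ Z.M) ≫ D.imageπ (Factorization.cone a)

/-- The sign of -g in the suspension is already part of `suspImageπ`, so none appears here. This is
one leg of the third square of the triangle; `coneInr_comp_coneFst` handles the other. -/
theorem coneImageInl_fst {Y Z : Factorization D.eta} (a : Y ⟶ Z) :
    D.coneImageInl a ≫ D.imageFunctor.map (Factorization.coneFst a) = D.suspImageπ Y := by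
  have h : D.red.map (biprod.inl : Y.N ⟶ Y.N ⊞ Z.M) ≫ D.red.map biprod.fst = 𝟙 _ := by
    rw [← Functor.map_comp, biprod.inl_fst, CategoryTheory.Functor.map_id]
  exact (Category.assoc _ _ _).trans
    ((congrArg _ (D.imageπ_naturality (Factorization.coneFst a))).trans
      ((Category.assoc _ _ _).symm.trans ((congrArg (· ≫ D.suspImageπ Y) h).trans
        (Category.id_comp _))))

theorem coneInr_comp_coneFst {Y Z : Factorization D.eta} (a : Y ⟶ Z) :
    Factorization.coneInr a ≫ Factorization.coneFst a = 0 :=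
  Factorization.hom_ext biprod.inr_fst biprod.inr_fst

/-- The image of a mapping cone is a pushout. -/
theorem isPushout_image_cone {Y Z : Factorization D.eta} (a : Y ⟶ Z)
    (hY : ∀ n, D.red.map Y.g n = 0 → n ∈ LinearMap.range (D.red.map Y.f).hom.hom) :
    IsPushout (D.imageι Y) (D.imageFunctor.map a) (D.coneImageInl a)
      (D.imageFunctor.map (Factorization.coneInr a)) :=
  D.isPushout_image_of_splitting a (Factorization.coneInr a) biprod.inl biprod.fst biprod.snd
    biprod.total biprod.inl biprod.fst biprod.snd biprod.inl_fst biprod.inl_snd biprod.inr_fst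
    biprod.inr_snd (biprod.inl_desc _ _) hY

end

end TwistDatum

/-! ### Isomorphisms of triangles. -/

theorem SuspTriangle.Isomorphic.trans {C : Type u} [Category.{v} C] {Sus : C ⥤ C}
    {t₁ t₂ t₃ : SuspTriangle Sus} (h : t₁.Isomorphic t₂) (h' : t₂.Isomorphic t₃) :
    t₁.Isomorphic t₃ := by
  obtain ⟨a, b, c, h₁, h₂, h₃⟩ := h
  obtain ⟨a', b', c', h₁', h₂', h₃'⟩ := h'
  refine ⟨a ≪≫ a', b ≪≫ b', c ≪≫ c', ?_, ?_, ?_⟩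
  · simp only [Iso.trans_hom, Category.assoc, ← h₁', reassoc_of% h₁]
  · simp only [Iso.trans_hom, Category.assoc, ← h₂', reassoc_of% h₂]
  · simp only [Iso.trans_hom, Category.assoc, ← h₃', reassoc_of% h₃, Functor.map_comp]

theorem SuspTriangle.Isomorphic.map {C : Type u} [Category.{v} C] {D : Type u'} [Category.{v'} D]
    {SusC : C ⥤ C} {SusD : D ⥤ D} {T : C ⥤ D} {ξ : SusC ⋙ T ⟶ T ⋙ SusD} {t t' : SuspTriangle SusC}
    (h : t.Isomorphic t') : (t.map T ξ).Isomorphic (t'.map T ξ) := by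
  obtain ⟨a, b, c, h₁, h₂, h₃⟩ := h
  refine ⟨T.mapIso a, T.mapIso b, T.mapIso c, ?_, ?_, ?_⟩
  · simp only [SuspTriangle.map, Functor.mapIso_hom, ← Functor.map_comp, h₁]
  · simp only [SuspTriangle.map, Functor.mapIso_hom, ← Functor.map_comp, h₂]
  · have := ξ.naturality a.hom
    simp only [Functor.comp_map] at this
    simp only [SuspTriangle.map, Functor.mapIso_hom, Category.assoc, ← this]
    rw [← T.map_comp_assoc, h₃, T.map_comp_assoc]

/-! ### From exactness modulo `w` to a triangle functor. -/

namespace TwistDatum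

section

variable {B : Type u} [Ring B] (D : TwistDatum B) (k : Type u) [Field k] [Algebra k D.quot]
  [Module.Finite k D.quot] [HasFrobeniusForm k D.quot]

open StableModCat in
/-- Reduction modulo `w` induces a triangle functor if all factorizations are exact modulo `w`. -/
theorem isTriangleFunctor_stableImage (hD : ∀ (Z : Factorization D.eta) (n : D.red.obj Z.N),
    D.red.map Z.g n = 0 → n ∈ LinearMap.range (D.red.map Z.f).hom.hom) :
    IsTriangleFunctor (HFactorization.Distinguished D.eta)
      (StableModCat.Distinguished k (A := D.quot)) D.stableImage := by
  have he : ∀ Z : Factorization D.eta, ∃ e : D.red.obj Z.N ⟶ injObj k (D.imageFunctor.obj Z),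
      D.imageι Z ≫ e = toInjObj k _ := fun Z =>
    exists_extension_of_projective k _ (D.imageι_injective Z) (projective_injObj k _) _
  -- This choice is fixed once: it defines both the suspension isomorphism θ and the cone comparison
  -- κ.
  choose e he using he
  have hθ := fun Z : Factorization D.eta =>
    exists_isIso_to_susp k (D.isPushout_suspImage Z (hD Z)) (D.projective_red Z.N) (he Z)
  choose θ hθ hiso using hθ
  have hnat : ∀ {Y Z : Factorization D.eta} (a : Y ⟶ Z),
      (proj D.quot).map (D.imageFunctor.map ((Factorization.suspension D.eta).map a) ≫ θ Z) =
        (proj D.quot).map (θ Y ≫ (suspFunctor k).map (D.imageFunctor.map a)) := by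
    intro Y Z a
    -- The extensions `e` need not be natural. Their naturality defect vanishes on the image, so it
    -- descends to the cokernel, and the defect of θ factors through the projective module I(im f̄)
    -- of `Z`.
    have h : D.imageι Y ≫ (D.red.map a.φ ≫ e Z - e Y ≫ injMap k (D.imageFunctor.map a)) =
        (0 : D.imageFunctor.obj Y ⟶ FGModuleCat.of D.quot PUnit.{u + 1}) ≫ 0 := by
      rw [Preadditive.comp_sub, ← Category.assoc, ← Category.assoc, he, toInjObj_naturality,
        ← imageι_naturality, Category.assoc, he, sub_self, zero_comp]
    have sq := D.isPushout_suspImage Y (hD Y)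
    refine proj_map_eq _ (projective_injObj k _) (sq.desc _ _ h) (toSusp k _)
      (D.suspImageπ_comp_injective ?_)
    rw [← Category.assoc, sq.inl_desc, Preadditive.sub_comp, Preadditive.comp_sub,
      ← Category.assoc, suspImageπ_naturality, Category.assoc, hθ, ← Category.assoc (D.suspImageπ Y),
      hθ, Category.assoc, toSusp_naturality, Category.assoc, Category.assoc]
  let ξ : HFactorization.suspension D.eta ⋙ D.stableImage ≅
      D.stableImage ⋙ StableModCat.suspension k :=
    CategoryTheory.Quotient.natIsoLift _ (NatIso.ofComponents
      (fun Z => @asIso _ _ _ _ ((proj D.quot).map (θ Z)) (hiso Z)) hnat)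
  refine ⟨inferInstance, ξ, ?_⟩
  rintro t ⟨Y, Z, a, ht⟩
  obtain ⟨κ, h₁, h₂, h₃⟩ := exists_isIso_to_cone k (D.isPushout_image_cone a (hD Y))
    (D.projective_red Y.N) (he Y)
  refine ⟨_, _, D.imageFunctor.map a, ht.map.trans
    ⟨Iso.refl _, Iso.refl _, @asIso _ _ _ _ ((proj D.quot).map κ) h₃, ?_, ?_, ?_⟩⟩
  · exact (Category.comp_id _).trans (Category.id_comp _).symm
  · refine Eq.trans ?_ (Category.id_comp _).symm
    exact congrArg (proj D.quot).map h₂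
  -- The third square commutes already for module maps. On the Ḡ₁ leg of the pushout both composites
  -- are `e Y ≫ toSusp`, and on the other leg both are zero.
  · have h : D.imageFunctor.map (Factorization.coneFst a) ≫ θ Y =
        κ ≫ coneFst k (D.imageFunctor.map a) := by
      refine (D.isPushout_image_cone a (hD Y)).hom_ext ?_ ?_
      · rw [← Category.assoc, coneImageInl_fst, hθ, ← Category.assoc, h₁, Category.assoc,
          coneInl_fst]
      · rw [← Category.assoc, ← Functor.map_comp, coneInr_comp_coneFst, Functor.map_zero,
          zero_comp, ← Category.assoc, h₂, coneInr_fst]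
    refine (congrArg _ (CategoryTheory.Functor.map_id _ _)).trans ((Category.comp_id _).trans ?_)
    exact congrArg (proj D.quot).map h

end

end TwistDatum

theorem corollary4p5 {k : Type u} [Field k] (q : k) (hq : q ≠ 0) :
    ∃ T : HFactorization (AlgB.datum q hq).eta ⥤ StableModCat (AlgA q hq),
      HFactorization.proj (AlgB.datum q hq).eta ⋙ T =
        (AlgB.datum q hq).imageFunctor ⋙ StableModCat.proj (AlgA q hq) ∧
      (∀ X : Factorization (AlgB.datum q hq).eta,
        T.obj ((HFactorization.proj (AlgB.datum q hq).eta).obj X) =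
          (StableModCat.proj (AlgA q hq)).obj (FGModuleCat.of (AlgA q hq)
            (LinearMap.range ((AlgB.datum q hq).red.map X.f).hom.hom))) ∧
      IsTriangleFunctor (HFactorization.Distinguished (AlgB.datum q hq).eta)
        (StableModCat.Distinguished k (A := AlgA q hq)) T :=
  ⟨(AlgB.datum q hq).stableImage, CategoryTheory.Quotient.lift_spec _ _ _, fun _ => rfl,
    (AlgB.datum q hq).isTriangleFunctor_stableImage k AlgB.mem_range_red_of_red_eq_zero⟩
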